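/- All spaces are topological spaces, all maps are continuous, and homotopies of pointed maps are relative to the base point. The homotopy pushout of $B\xleftarrow{p}A\xrightarrow{q}C$ is the quotient of $B\sqcup C\sqcup (A\times[0,1])$ by $(a,0)\sim p(a)$, $(a,1)\sim q(a)$; write $\mathrm{inl},\mathrm{inr}$ for the maps from $B$ and $C$ to it and $\mathrm{push}(a)$ for the path $t\mapsto(a,t)$ from $\mathrm{inl}(p(a))$ to $\mathrm{inr}(q(a))$. Write $p\cdot q$ for "first $p$, then $q$". For pointed spaces $A,B$ (base points $\star$) define by homotopy pushouts the suspension $\mathrm{Susp}\,A$ (of $1\leftarrow A\to 1$, with poles $\mathrm{north}$, $\mathrm{south}$ and meridians $\mathrm{merid}(a)$ from $\mathrm{north}$ to $\mathrm{south}$, pointed by $\mathrm{north}$), the join $A*B$ (of $A\leftarrow A\times B\to B$, pointed by $\mathrm{inl}(\star)$) and the wedge $A\vee B$ (of $A\leftarrow 1\to B$). Put $\sigma(a)=\mathrm{merid}(a)\cdot\mathrm{merid}(\star)^{-1}$, a loop at $\mathrm{north}$. Let $S^0=\{\mathrm{true},\mathrm{false}\}$, pointed by $\mathrm{true}$, let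 $S^{n+1}=\mathrm{Susp}\,S^n$, and let $\pi_n(C)$ be the set of homotopy classes of pointed maps $S^n\to C$, with neutral element $0$ the class of the constant map. The suspension map $\sigma_*:\pi_n(C)\to\pi_{n+1}(\mathrm{Susp}\,C)$ sends $[f]$ to the class of the map $\mathrm{north},\mathrm{south}\mapsto\mathrm{north}$, $\mathrm{merid}(s)\mapsto\sigma(f(s))$. For pointed maps $f:\mathrm{Susp}\,A\to C$ and $g:\mathrm{Susp}\,B\to C$, the generalised Whitehead map $f\cdot_w g:A*B\to C$ sends $\mathrm{inl}(a)$ and $\mathrm{inr}(b)$ to $\star$ and the path $\mathrm{push}(a,b)$ to $g(\sigma(b))\cdot f(\sigma(a))$. The Whitehead map $W:A*B\to\mathrm{Susp}\,A\vee\mathrm{Susp}\,B$ sends $\mathrm{inl}(a)\mapsto\mathrm{inr}(\mathrm{north})$, $\mathrm{inr}(b)\mapsto\mathrm{inl}(\mathrm{north})$ and $\mathrm{push}(a,b)\mapsto\mathrm{inr}(\sigma(b))\cdot\mathrm{push}^{-1}\cdot\mathrm{inl}(\sigma(a))$. Let $\smile:S^n\times S^m\to S^{n+m}$ be given by $\mathrm{false}\smile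 y=y$, $\mathrm{true}\smile y=\star$ for $n=0$, and by $\mathrm{north}\smile y=\mathrm{south}\smile y=\mathrm{north}$, $\mathrm{merid}(a)\smile y=\sigma(a\smile y)$ for $S^{n+1}=\mathrm{Susp}\,S^n$. Let $F_{n,m}:S^n*S^m\to S^{n+m+1}$ send $\mathrm{inl}(a)\mapsto\mathrm{north}$, $\mathrm{inr}(b)\mapsto\mathrm{south}$, $\mathrm{push}(a,b)\mapsto\mathrm{merid}(a\smile b)$. **Theorem 6.23 (with Propositions 6.21 and 6.22).** (1) For all pointed spaces $A,B,C$ and pointed maps $f:\mathrm{Susp}\,A\to C$, $g:\mathrm{Susp}\,B\to C$, the pointed map $\mathrm{Susp}(f\cdot_w g):\mathrm{Susp}(A*B)\to\mathrm{Susp}\,C$ is pointed homotopic to the constant map. (2) For all $n,m\ge 0$ the map $F_{n,m}$ has a pointed homotopy inverse. Let $F_{n,m}^{-1}$ be any such inverse, let $C$ be any pointed space, and for $f:S^{n+1}\to C$, $g:S^{m+1}\to C$ pointed define the Whitehead product by $[[f],[g]]=[\nabla\circ(f\vee g)\circ W\circ F_{n,m}^{-1}]\in\pi_{n+m+1}(C)$,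 where $\nabla:C\vee C\to C$ is the fold map; this depends only on the classes of $f$ and $g$. Then (a) $[[f],[g]]=[(f\cdot_w g)\circ F_{n,m}^{-1}]$, and $\mathrm{Susp}((f\cdot_w g)\circ F_{n,m}^{-1})$ is pointed homotopic to the constant map, for all such $f,g$; (b) for all $x\in\pi_{n+1}(C)$ and $y\in\pi_{m+1}(C)$, the Whitehead product $[x,y]\in\pi_{n+m+1}(C)$ lies in the kernel of the suspension map, i.e. $\sigma_*[x,y]=0$ in $\pi_{n+m+2}(\mathrm{Susp}\,C)$. -/

import Mathlib

open scoped unitInterval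

universe u v w

namespace PtdHtpy

noncomputable section

/-! ## Homotopy pushouts -/

section Pushout

variable {A : Type u} {B : Type v} {C : Type w}
  [TopologicalSpace A] [TopologicalSpace B] [TopologicalSpace C]

/-- The gluing relation of the homotopy pushout of `B ← A → C`: in the disjoint union of `B`, `C`
and the cylinder `A × [0,1]`, the end `A × 0` is glued to `B` along `f`, the end `A × 1` to `C`
along `g`. -/
inductive PushoutRel (f : C(A, B)) (g : C(A, C)) : B ⊕ C ⊕ (A × I) → B ⊕ C ⊕ (A × I) → Prop
  | left (a : A) : PushoutRel f g (Sum.inr (Sum.inr (a, 0))) (Sum.inl (f a))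
  | right (a : A) : PushoutRel f g (Sum.inr (Sum.inr (a, 1))) (Sum.inr (Sum.inl (g a)))

/-- The homotopy pushout (double mapping cylinder) of `B ← A → C`, with the quotient topology. -/
def Pushout (f : C(A, B)) (g : C(A, C)) : Type (max u v w) := Quot (PushoutRel f g)

namespace Pushout

instance (f : C(A, B)) (g : C(A, C)) : TopologicalSpace (Pushout f g) :=
  inferInstanceAs (TopologicalSpace (Quot (PushoutRel f g)))

variable (f : C(A, B)) (g : C(A, C))

/-- The inclusion of the left leg. -/
def inl : C(B, Pushout f g) where
  toFun b := Quot.mk _ (Sum.inl b)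
  continuous_toFun := continuous_quot_mk.comp continuous_inl

/-- The inclusion of the right leg. -/
def inr : C(C, Pushout f g) where
  toFun c := Quot.mk _ (Sum.inr (Sum.inl c))
  continuous_toFun := continuous_quot_mk.comp (continuous_inr.comp continuous_inl)

/-- The cylinder, mapped to the homotopy pushout. -/
def cyl : C(A × I, Pushout f g) where
  toFun p := Quot.mk _ (Sum.inr (Sum.inr p))
  continuous_toFun := continuous_quot_mk.comp (continuous_inr.comp continuous_inr)

/-- The path `push a` from `inl (f a)` to `inr (g a)`. -/
def push (a : A) : Path (inl f g (f a)) (inr f g (g a)) where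
  toFun t := cyl f g (a, t)
  continuous_toFun := by fun_prop
  source' := Quot.sound (PushoutRel.left a)
  target' := Quot.sound (PushoutRel.right a)

variable {f g} {X : Type*} [TopologicalSpace X]

/-- The recursor: a map out of the homotopy pushout is given by maps on the two legs and a
continuous family of paths joining them. -/
def desc (k : C(B, X)) (l : C(C, X)) (p : ∀ a, Path (k (f a)) (l (g a)))
    (hp : Continuous fun x : A × I => p x.1 x.2) : C(Pushout f g, X) where
  toFun := Quot.lift (Sum.elim k (Sum.elim l fun x : A × I => p x.1 x.2)) (by
    rintro _ _ (a | a)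
    · simp
    · simp)
  continuous_toFun := continuous_quot_lift _
    (k.continuous.sumElim (l.continuous.sumElim hp))

section desc

variable (k : C(B, X)) (l : C(C, X)) (p : ∀ a, Path (k (f a)) (l (g a)))
  (hp : Continuous fun x : A × I => p x.1 x.2)

@[simp] theorem desc_inl (b : B) : desc k l p hp (inl f g b) = k b := rfl
@[simp] theorem desc_inr (c : C) : desc k l p hp (inr f g c) = l c := rfl
@[simp] theorem desc_cyl (x : A × I) : desc k l p hp (cyl f g x) = p x.1 x.2 := rfl
@[simp] theorem desc_push (a : A) (t : I) : desc k l p hp (push f g a t) = p a t := rfl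

end desc

theorem continuous_push : Continuous fun x : A × I => push f g x.1 x.2 :=
  (cyl f g).continuous

theorem ind {P : Pushout f g → Prop} (hl : ∀ b, P (inl f g b)) (hr : ∀ c, P (inr f g c))
    (hp : ∀ a t, P (push f g a t)) (z : Pushout f g) : P z := by
  induction z using Quot.ind with
  | mk z => rcases z with b | c | ⟨a, t⟩; exacts [hl b, hr c, hp a t]

instance [CompactSpace A] [CompactSpace B] [CompactSpace C] : CompactSpace (Pushout f g) :=
  inferInstanceAs (CompactSpace (Quot (PushoutRel f g)))

/-- Homotopies between maps out of a homotopy pushout, given on the pieces. -/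
theorem homotopicRel_of {k₀ k₁ : C(Pushout f g, X)} (S : Set (Pushout f g))
    (K : C(B, C(I, X))) (L : C(C, C(I, X))) (H : C(A × I, C(I, X)))
    (hK : ∀ a s, H (a, 0) s = K (f a) s) (hL : ∀ a s, H (a, 1) s = L (g a) s)
    (h0l : ∀ b, K b 0 = k₀ (inl f g b)) (h0r : ∀ c, L c 0 = k₀ (inr f g c))
    (h0p : ∀ a t, H (a, t) 0 = k₀ (push f g a t))
    (h1l : ∀ b, K b 1 = k₁ (inl f g b)) (h1r : ∀ c, L c 1 = k₁ (inr f g c))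
    (h1p : ∀ a t, H (a, t) 1 = k₁ (push f g a t))
    (hS : ∀ z ∈ S, (∃ b, inl f g b = z ∧ ∀ s, K b s = k₀ (inl f g b)) ∨
      ∃ c, inr f g c = z ∧ ∀ s, L c s = k₀ (inr f g c)) :
    k₀.HomotopicRel k₁ S := by
  let D : C(Pushout f g, C(I, X)) := desc K L
    (fun a => ⟨⟨fun t => H (a, t), by fun_prop⟩, by ext s; exact hK a s, by ext s; exact hL a s⟩)
    (by exact H.continuous)
  refine ⟨⟨⟨⟨fun x => D x.2 x.1, ?_⟩, ?_, ?_⟩, ?_⟩⟩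
  · fun_prop
  · exact fun z => ind (P := fun z => D z 0 = k₀ z) h0l h0r h0p z
  · exact fun z => ind (P := fun z => D z 1 = k₁ z) h1l h1r h1p z
  · rintro s z hz
    obtain ⟨b, rfl, h⟩ | ⟨c, rfl, h⟩ := hS z hz
    exacts [h s, h s]

end Pushout

end Pushout

/-! ## Pointed spaces and homotopy classes -/

/-- A pointed topological space. -/
structure PtdSpace : Type (u + 1) where
  carrier : Type u
  [str : TopologicalSpace carrier]
  pt : carrier

instance : CoeSort PtdSpace.{u} (Type u) := ⟨PtdSpace.carrier⟩

attribute [instance] PtdSpace.str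

/-- Pointed continuous maps. -/
structure PMap (X : PtdSpace.{u}) (Y : PtdSpace.{v}) where
  toMap : C(X, Y)
  map_pt : toMap X.pt = Y.pt

namespace PMap

variable {X : PtdSpace.{u}} {Y : PtdSpace.{v}} {Z : PtdSpace.{w}}

/-- The identity. -/
protected def id (X : PtdSpace.{u}) : PMap X X := ⟨ContinuousMap.id X, rfl⟩

/-- Composition, `g ∘ f`. -/
def comp (g : PMap Y Z) (f : PMap X Y) : PMap X Z :=
  ⟨g.toMap.comp f.toMap, by simp [f.map_pt, g.map_pt]⟩

/-- The constant map to the base point. -/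
def const (X : PtdSpace.{u}) (Y : PtdSpace.{v}) : PMap X Y := ⟨ContinuousMap.const X Y.pt, rfl⟩

/-- Pointed homotopy: homotopy relative to the base point. -/
def Homotopic (f g : PMap X Y) : Prop := f.toMap.HomotopicRel g.toMap {X.pt}

/-- Pointed homotopy as a setoid. -/
instance homotopySetoid (X : PtdSpace.{u}) (Y : PtdSpace.{v}) : Setoid (PMap X Y) where
  r := Homotopic
  iseqv := ⟨fun f => .refl f.toMap, fun h => .symm h, fun h h' => .trans h h'⟩

/-- `g` is a homotopy inverse of `f` in the category of pointed spaces. -/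
def IsHomotopyInverse (f : PMap X Y) (g : PMap Y X) : Prop :=
  (f.comp g).Homotopic (PMap.id Y) ∧ (g.comp f).Homotopic (PMap.id X)

end PMap

/-! ## Suspensions, joins and wedges -/

/-- Concatenation of continuous families of paths is continuous. -/
theorem continuous_trans {T : Type u} {X : Type v} [TopologicalSpace T] [TopologicalSpace X]
    {a b c : T → X} (p : ∀ t, Path (a t) (b t)) (q : ∀ t, Path (b t) (c t))
    (hp : Continuous fun x : T × I => p x.1 x.2) (hq : Continuous fun x : T × I => q x.1 x.2) :
    Continuous fun x : T × I => (p x.1).trans (q x.1) x.2 :=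
  Path.trans_continuous_family p hp q hq

/-- The constant map `X → 1`. -/
def toUnit (X : Type u) [TopologicalSpace X] : C(X, Unit) := ContinuousMap.const X ()

/-- The (unreduced) suspension, pointed by `north`. -/
def susp (X : PtdSpace.{u}) : PtdSpace.{u} where
  carrier := Pushout (toUnit X) (toUnit X)
  pt := Pushout.inl _ _ ()

section susp

variable {X : PtdSpace.{u}} {Y : PtdSpace.{v}}

/-- The first pole; it is the base point of the suspension. -/
def north : susp X := Pushout.inl (toUnit X) (toUnit X) ()

/-- The second pole. -/
def south : susp X := Pushout.inr (toUnit X) (toUnit X) ()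

/-- The meridian through `x`. -/
def merid (x : X) : Path (north : susp X) south := Pushout.push (toUnit X) (toUnit X) x

theorem continuous_merid : Continuous fun x : X × I => merid x.1 x.2 := Pushout.continuous_push

/-- The loop `σ x = merid x · (merid ⋆)⁻¹` at `north`. -/
def sigma (x : X) : Path (north : susp X) north := (merid x).trans (merid X.pt).symm

theorem continuous_sigma : Continuous fun x : X × I => sigma x.1 x.2 :=
  continuous_trans (fun x : X => merid x) (fun _ : X => (merid X.pt).symm) continuous_merid
    ((merid X.pt).symm.continuous.comp continuous_snd)

/-- Maps out of a suspension. -/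
def suspDesc {Z : Type w} [TopologicalSpace Z] (a b : Z) (p : X → Path a b)
    (hp : Continuous fun x : X × I => p x.1 x.2) : C(susp X, Z) :=
  Pushout.desc (f := toUnit X) (g := toUnit X) (ContinuousMap.const Unit a)
    (ContinuousMap.const Unit b) p hp

/-- Functoriality of the suspension: `north ↦ north`, `south ↦ south`,
`merid x t ↦ merid (f x) t`. -/
def suspMap (f : PMap X Y) : PMap (susp X) (susp Y) where
  toMap := suspDesc north south (fun x => merid (f.toMap x))
    (continuous_merid.comp (by fun_prop : Continuous fun x : X × I => (f.toMap x.1, x.2)))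
  map_pt := rfl

/-- The map `Susp X → Susp Y` adjoint to `σ ∘ f : X → Ω (Susp Y)`: it sends both poles to `north`
and `merid x t` to `σ (f x) t`. -/
def sigmaAdj (f : PMap X Y) : PMap (susp X) (susp Y) where
  toMap := suspDesc north north (fun x => sigma (f.toMap x))
    (continuous_sigma.comp (by fun_prop : Continuous fun x : X × I => (f.toMap x.1, x.2)))
  map_pt := rfl

theorem sigmaAdj_homotopic {f g : PMap X Y} (h : f.Homotopic g) :
    (sigmaAdj f).Homotopic (sigmaAdj g) := by
  obtain ⟨H⟩ := h
  refine Pushout.homotopicRel_of _ (ContinuousMap.const _ (ContinuousMap.const _ north))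
    (ContinuousMap.const _ (ContinuousMap.const _ north))
    (ContinuousMap.curry ⟨fun x : (X × I) × I => sigma (H (x.2, x.1.1)) x.1.2,
      continuous_sigma.comp (by fun_prop : Continuous
        fun x : (X × I) × I => (H (x.2, x.1.1), x.1.2))⟩)
    (fun a s => ?_) (fun a s => ?_) (fun _ => rfl) (fun _ => rfl) (fun a t => ?_)
    (fun _ => rfl) (fun _ => rfl) (fun a t => ?_)
    (fun z hz => .inl ⟨(), (Set.mem_singleton_iff.1 hz).symm, fun _ => rfl⟩)
  · exact (sigma (H (s, a))).source
  · exact (sigma (H (s, a))).target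
  · exact congrArg (fun y => sigma y t) (H.apply_zero a)
  · exact congrArg (fun y => sigma y t) (H.apply_one a)

end susp

section join

variable {A : PtdSpace.{u}} {B : PtdSpace.{v}} {C : PtdSpace.{w}}

/-- The join `A * B`, the homotopy pushout of the projections `A ← A × B → B`; it is pointed by
`inl ⋆`. -/
def join (A : PtdSpace.{u}) (B : PtdSpace.{v}) : PtdSpace.{max u v} where
  carrier := Pushout (ContinuousMap.fst : C(A × B, A)) (ContinuousMap.snd : C(A × B, B))
  pt := Pushout.inl _ _ A.pt

/-- Maps out of a join. -/
def joinDesc {Z : Type w} [TopologicalSpace Z] (k : C(A, Z)) (l : C(B, Z))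
    (p : ∀ x : A × B, Path (k x.1) (l x.2))
    (hp : Continuous fun x : (A × B) × I => p x.1 x.2) : C(join A B, Z) :=
  Pushout.desc (f := (ContinuousMap.fst : C(A × B, A))) (g := (ContinuousMap.snd : C(A × B, B)))
    k l p hp

/-- The inclusion of the base point. -/
def ptMap (X : PtdSpace.{u}) : C(Unit, X) := ContinuousMap.const Unit X.pt

/-- The wedge `A ∨ B`, the homotopy pushout of the base point inclusions `A ← 1 → B`. -/
abbrev Wedge (A : PtdSpace.{u}) (B : PtdSpace.{v}) : Type (max u v) :=
  Pushout (ptMap A) (ptMap B)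

/-- The left summand of the wedge. -/
def wedgeInl (A : PtdSpace.{u}) (B : PtdSpace.{v}) : C(A, Wedge A B) := Pushout.inl _ _

/-- The right summand of the wedge. -/
def wedgeInr (A : PtdSpace.{u}) (B : PtdSpace.{v}) : C(B, Wedge A B) := Pushout.inr _ _

/-- The path of the wedge joining its two base points. -/
def wedgePush (A : PtdSpace.{u}) (B : PtdSpace.{v}) :
    Path (wedgeInl A B A.pt) (wedgeInr A B B.pt) := Pushout.push (ptMap A) (ptMap B) ()

/-- The wedge `f ∨ g` of two pointed maps. -/
def wedgeMap {A' : PtdSpace.{u}} {B' : PtdSpace.{v}} {C' : PtdSpace.{w}} {D' : PtdSpace.{w}}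
    (f : PMap A' C') (g : PMap B' D') : C(Wedge A' B', Wedge C' D') :=
  Pushout.desc ((wedgeInl C' D').comp f.toMap) ((wedgeInr C' D').comp g.toMap)
    (fun _ => (wedgePush C' D').cast (congrArg (wedgeInl C' D') f.map_pt)
      (congrArg (wedgeInr C' D') g.map_pt))
    ((wedgePush C' D').continuous.comp continuous_snd)

/-- The fold map `∇ : C ∨ C → C`. -/
def fold (C : PtdSpace.{w}) : C(Wedge C C, C) :=
  Pushout.desc (ContinuousMap.id C) (ContinuousMap.id C) (fun _ => Path.refl C.pt)
    continuous_const

/-- The path `inr (σ b) · push⁻¹ · inl (σ a)` in `Susp A ∨ Susp B`. -/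
def whiteheadPath (x : A × B) :
    Path (wedgeInr (susp A) (susp B) north) (wedgeInl (susp A) (susp B) north) :=
  (((sigma x.2).map (wedgeInr (susp A) (susp B)).continuous).trans
    (wedgePush (susp A) (susp B)).symm).trans
      ((sigma x.1).map (wedgeInl (susp A) (susp B)).continuous)

theorem continuous_whiteheadPath :
    Continuous fun x : (A × B) × I => whiteheadPath x.1 x.2 :=
  continuous_trans
    (fun x : A × B => ((sigma x.2).map (wedgeInr (susp A) (susp B)).continuous).trans
      (wedgePush (susp A) (susp B)).symm)
    (fun x : A × B => (sigma x.1).map (wedgeInl (susp A) (susp B)).continuous)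
    (continuous_trans
      (fun x : A × B => (sigma x.2).map (wedgeInr (susp A) (susp B)).continuous)
      (fun _ : A × B => (wedgePush (susp A) (susp B)).symm)
      ((wedgeInr (susp A) (susp B)).continuous.comp (continuous_sigma.comp
        (by fun_prop : Continuous fun x : (A × B) × I => (x.1.2, x.2))))
      ((wedgePush (susp A) (susp B)).symm.continuous.comp continuous_snd))
    ((wedgeInl (susp A) (susp B)).continuous.comp (continuous_sigma.comp
      (by fun_prop : Continuous fun x : (A × B) × I => (x.1.1, x.2))))

/-- The Whitehead map `W : A * B → Susp A ∨ Susp B`, with `inl a ↦ inr north`,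
`inr b ↦ inl north` and `push (a, b) ↦ inr (σ b) · push⁻¹ · inl (σ a)`. -/
def whiteheadMap (A : PtdSpace.{u}) (B : PtdSpace.{v}) :
    C(join A B, Wedge (susp A) (susp B)) :=
  joinDesc (ContinuousMap.const A (wedgeInr (susp A) (susp B) north))
    (ContinuousMap.const B (wedgeInl (susp A) (susp B) north))
    whiteheadPath continuous_whiteheadPath

/-- The pointed map `∇ ∘ (f ∨ g) ∘ W : A * B → C`. -/
def whiteheadComp (f : PMap (susp A) C) (g : PMap (susp B) C) : PMap (join A B) C where
  toMap := ((fold C).comp (wedgeMap f g)).comp (whiteheadMap A B)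
  map_pt := g.map_pt

/-- The loop `f (σ x)` at the base point of `C`, for a pointed map `f : Susp A → C`. -/
def loopAt (f : PMap (susp A) C) (x : A) : Path C.pt C.pt :=
  ((sigma x).map f.toMap.continuous).cast f.map_pt.symm f.map_pt.symm

theorem continuous_loopAt (f : PMap (susp A) C) :
    Continuous fun x : A × I => loopAt f x.1 x.2 :=
  f.toMap.continuous.comp continuous_sigma

/-- The path `g (σ b) · f (σ a)`. -/
def genWhiteheadPath (f : PMap (susp A) C) (g : PMap (susp B) C) (x : A × B) : Path C.pt C.pt :=
  (loopAt g x.2).trans (loopAt f x.1)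

theorem continuous_genWhiteheadPath (f : PMap (susp A) C) (g : PMap (susp B) C) :
    Continuous fun x : (A × B) × I => genWhiteheadPath f g x.1 x.2 := by
  have hg : Continuous fun x : (A × B) × I => (x.1.2, x.2) := by fun_prop
  have hf : Continuous fun x : (A × B) × I => (x.1.1, x.2) := by fun_prop
  have hg' := (continuous_loopAt g).comp hg
  have hf' := (continuous_loopAt f).comp hf
  exact continuous_trans (fun x : A × B => loopAt g x.2) (fun x : A × B => loopAt f x.1) hg' hf'

/-- The generalised Whitehead map `f ·_w g : A * B → C`, with `inl a ↦ ⋆`, `inr b ↦ ⋆` and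
`push (a, b) ↦ g (σ b) · f (σ a)`. -/
def genWhitehead (f : PMap (susp A) C) (g : PMap (susp B) C) : PMap (join A B) C where
  toMap := joinDesc (ContinuousMap.const A C.pt) (ContinuousMap.const B C.pt)
    (genWhiteheadPath f g) (continuous_genWhiteheadPath f g)
  map_pt := rfl

theorem wedgeMap_homotopicRel {A' : PtdSpace.{u}} {B' : PtdSpace.{v}} {C' : PtdSpace.{w}}
    {D' : PtdSpace.{w}} {f f' : PMap A' C'} {g g' : PMap B' D'} (hf : f.Homotopic f')
    (hg : g.Homotopic g') :
    (wedgeMap f g).HomotopicRel (wedgeMap f' g') {wedgeInr A' B' B'.pt} := by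
  obtain ⟨H⟩ := hf
  obtain ⟨K⟩ := hg
  have hH : ∀ s, H (s, A'.pt) = C'.pt := fun s => (H.eq_fst s rfl).trans f.map_pt
  have hK : ∀ s, K (s, B'.pt) = D'.pt := fun s => (K.eq_fst s rfl).trans g.map_pt
  refine Pushout.homotopicRel_of _
    (ContinuousMap.curry ⟨fun x : A' × I => wedgeInl C' D' (H (x.2, x.1)), by fun_prop⟩)
    (ContinuousMap.curry ⟨fun x : B' × I => wedgeInr C' D' (K (x.2, x.1)), by fun_prop⟩)
    (ContinuousMap.curry ⟨fun x : (Unit × I) × I => wedgePush C' D' x.1.2, by fun_prop⟩)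
    (fun a s => ?_) (fun a s => ?_) (fun b => ?_) (fun c => ?_) (fun _ _ => rfl)
    (fun b => ?_) (fun c => ?_) (fun _ _ => rfl)
    (fun z hz => .inr ⟨B'.pt, (Set.mem_singleton_iff.1 hz).symm, fun s => ?_⟩)
  · exact (wedgePush C' D').source.trans (congrArg (wedgeInl C' D') (hH s).symm)
  · exact (wedgePush C' D').target.trans (congrArg (wedgeInr C' D') (hK s).symm)
  · exact congrArg (wedgeInl C' D') (H.apply_zero b)
  · exact congrArg (wedgeInr C' D') (K.apply_zero c)
  · exact congrArg (wedgeInl C' D') (H.apply_one b)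
  · exact congrArg (wedgeInr C' D') (K.apply_one c)
  · exact congrArg (wedgeInr C' D') (K.eq_fst s rfl)

theorem whiteheadComp_homotopic {f f' : PMap (susp A) C} {g g' : PMap (susp B) C}
    (hf : f.Homotopic f') (hg : g.Homotopic g') :
    (whiteheadComp f g).Homotopic (whiteheadComp f' g') := by
  obtain ⟨H⟩ := (wedgeMap_homotopicRel hf hg).comp_continuousMap (fold C)
  refine ⟨⟨⟨⟨fun x => H (x.1, whiteheadMap A B x.2), by fun_prop⟩, fun z => ?_, fun z => ?_⟩,
    ?_⟩⟩
  · exact H.apply_zero _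
  · exact H.apply_one _
  · rintro s z hz
    obtain rfl := Set.mem_singleton_iff.1 hz
    exact H.eq_fst s rfl

end join

/-! ## Spheres -/

/-- The spheres: `S⁰ = {true, false}`, pointed by `true`, and `Sⁿ⁺¹ = Susp Sⁿ`. -/
def sphere : ℕ → PtdSpace.{0}
  | 0 => ⟨Bool, true⟩
  | n + 1 => susp (sphere n)

theorem compactSpace_sphere : ∀ n, CompactSpace (sphere n)
  | 0 => inferInstanceAs (CompactSpace Bool)
  | n + 1 =>
    have := compactSpace_sphere n
    inferInstanceAs (CompactSpace (Pushout (toUnit (sphere n)) (toUnit (sphere n))))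

/-- Continuous real functions separate the points of the spheres. -/
theorem exists_ne_sphere : ∀ (n : ℕ) (x y : sphere n), x ≠ y → ∃ k : C(sphere n, ℝ), k x ≠ k y
  | 0 => by
    intro x y h
    let k : C(Bool, ℝ) := ⟨fun b => if b then 1 else 0, continuous_of_discreteTopology⟩
    have key : ∀ a b : Bool, a ≠ b → k a ≠ k b := by
      intro a b
      cases a <;> cases b <;> simp [k]
    exact ⟨k, key x y h⟩
  | n + 1 => by
    intro x y h
    by_contra! H
    let height : C(susp (sphere n), ℝ) := suspDesc (X := sphere n) 0 1
      (fun _ => ⟨⟨fun t => (t : ℝ), by fun_prop⟩, by simp, by simp⟩) (by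
        change Continuous fun x : sphere n × I => (x.2 : ℝ)
        fun_prop)
    let bump (k : C(sphere n, ℝ)) : C(susp (sphere n), ℝ) := suspDesc (X := sphere n) 0 0
      (fun a => ⟨⟨fun t => (t : ℝ) * (1 - t) * k a, by fun_prop⟩, by simp, by simp⟩) (by
        change Continuous fun x : sphere n × I => (x.2 : ℝ) * (1 - x.2) * k x.1
        fun_prop)
    have normal : ∀ z : susp (sphere n), ∃ a t, z = merid a t := fun z =>
      Pushout.ind (P := fun z : susp (sphere n) => ∃ a t, z = merid a t)
        (fun _ => ⟨(sphere n).pt, 0, (merid _).source.symm⟩)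
        (fun _ => ⟨(sphere n).pt, 1, (merid _).target.symm⟩) (fun a t => ⟨a, t, rfl⟩) z
    obtain ⟨a, t, rfl⟩ := normal x
    obtain ⟨b, s, rfl⟩ := normal y
    have hts : t = s := Subtype.ext (H height)
    subst hts
    by_cases hab : a = b
    · exact h (by rw [hab])
    obtain ⟨k, hk⟩ := exists_ne_sphere n a b hab
    have hb : (t : ℝ) * (1 - t) * k a = (t : ℝ) * (1 - t) * k b := H (bump k)
    have h0 : (t : ℝ) * (1 - t) = 0 := by
      by_contra hne
      exact hk (mul_left_cancel₀ hne hb)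
    rcases mul_eq_zero.1 h0 with h0 | h0
    · obtain rfl : t = 0 := Subtype.ext h0
      exact h ((merid a).source.trans (merid b).source.symm)
    · have h1 : (t : ℝ) = 1 := by linarith
      obtain rfl : t = 1 := Subtype.ext h1
      exact h ((merid a).target.trans (merid b).target.symm)

instance (n : ℕ) : LocallyCompactSpace (sphere n) := by
  have := compactSpace_sphere n
  have : T2Space (sphere n) := ⟨fun x y h => by
    obtain ⟨k, hk⟩ := exists_ne_sphere n x y h
    exact separated_by_continuous k.continuous hk⟩
  infer_instance

/-- The multiplication `Sⁿ × Sᵐ → Sᵐ⁺ⁿ`, curried: `false ⌣ y = y`, `true ⌣ y = ⋆` for `n = 0`, and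
`north ⌣ y = south ⌣ y = north`, `merid a i ⌣ y = σ (a ⌣ y) i` in the inductive step. -/
def cup (m : ℕ) : ∀ n : ℕ, C(sphere n, C(sphere m, sphere (m + n)))
  | 0 =>
    (⟨fun b => if b then ContinuousMap.const _ (sphere m).pt else ContinuousMap.id _,
      continuous_of_discreteTopology⟩ : C(Bool, C(sphere m, sphere m)))
  | n + 1 =>
    suspDesc (X := sphere n) (ContinuousMap.const (sphere m) (north : susp (sphere (m + n))))
      (ContinuousMap.const (sphere m) (north : susp (sphere (m + n))))
      (fun a =>
        { toFun := fun i => ⟨fun y => sigma (cup m n a y) i,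
            continuous_sigma.comp (by fun_prop : Continuous fun y => (cup m n a y, i))⟩
          continuous_toFun := ContinuousMap.continuous_of_continuous_uncurry _
            (continuous_sigma.comp (by fun_prop : Continuous
              fun x : I × sphere m => (cup m n a x.2, x.1)))
          source' := by ext y; exact (sigma (cup m n a y)).source
          target' := by ext y; exact (sigma (cup m n a y)).target })
      (ContinuousMap.continuous_of_continuous_uncurry _
        (continuous_sigma.comp (by fun_prop : Continuous
          fun x : (sphere n × I) × sphere m => (cup m n x.1.1 x.2, x.1.2))))

/-- The map `F : Sⁿ * Sᵐ → Sᵐ⁺ⁿ⁺¹` with `inl a ↦ north`, `inr b ↦ south` and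
`push (a, b) i ↦ merid (a ⌣ b) i`. -/
def joinSphere (n m : ℕ) : PMap (join (sphere n) (sphere m)) (sphere (m + n + 1)) where
  toMap := joinDesc (ContinuousMap.const _ (north : susp (sphere (m + n))))
    (ContinuousMap.const _ (south : susp (sphere (m + n))))
    (fun x => merid (cup m n x.1 x.2))
    (continuous_merid.comp (by fun_prop : Continuous
      fun x : (sphere n × sphere m) × I => (cup m n x.1.1 x.1.2, x.2)))
  map_pt := rfl

/-! ## Homotopy groups, the suspension map and the Whitehead product -/

/-- `π_n(C)`: pointed homotopy classes of pointed maps `Sⁿ → C`. -/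
def HtpyGroup (n : ℕ) (C : PtdSpace.{w}) : Type w :=
  Quotient (PMap.homotopySetoid (sphere n) C)

namespace HtpyGroup

variable {n m : ℕ} {C : PtdSpace.{w}}

/-- The class of a pointed map `Sⁿ → C`. -/
def mk (f : PMap (sphere n) C) : HtpyGroup n C := Quotient.mk _ f

/-- The neutral element, the class of the constant map. -/
instance : Zero (HtpyGroup n C) := ⟨mk (PMap.const _ _)⟩

/-- The suspension map `σ_* : π_n(C) → π_{n+1}(Susp C)`: composition with `σ : C → Ω (Susp C)`,
followed by the adjunction between `Susp` and `Ω`. -/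
def suspension : HtpyGroup n C → HtpyGroup (n + 1) (susp C) :=
  Quotient.lift (fun f => mk (n := n + 1) (sigmaAdj f))
    fun _ _ h => Quotient.sound (sigmaAdj_homotopic h)

/-- The Whitehead product `[x, y]` of `x = [f]` and `y = [g]`, the class of
`∇ ∘ (f ∨ g) ∘ W ∘ e`. Here `e` is a pointed map from the sphere to the join of spheres, to be
taken homotopy inverse to `joinSphere n m`. -/
def whitehead (e : PMap (sphere (m + n + 1)) (join (sphere n) (sphere m))) :
    HtpyGroup (n + 1) C → HtpyGroup (m + 1) C → HtpyGroup (m + n + 1) C :=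
  Quotient.lift₂ (fun f g => mk ((whiteheadComp (A := sphere n) (B := sphere m) f g).comp e))
    fun f g f' g' hf hg => Quotient.sound (by
      obtain ⟨H⟩ := whiteheadComp_homotopic (A := sphere n) (B := sphere m) hf hg
      refine ⟨⟨⟨⟨fun x => H (x.1, e.toMap x.2), by fun_prop⟩, fun z => ?_, fun z => ?_⟩, ?_⟩⟩
      · exact H.apply_zero _
      · exact H.apply_one _
      · rintro s z hz
        obtain rfl := Set.mem_singleton_iff.1 hz
        exact H.eq_fst s e.map_pt)

end HtpyGroup

end

end PtdHtpy

open PtdHtpy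

/-! Nullity of `Susp (f ·_w g)` is an Eckmann–Hilton argument. Fix `(a, b)` and send `(τ, φ)` in the
unit square to the point of height `φ` on the meridian through the point `τ` of the loop `g(σ b) ·
f(σ a)`. The left half of the square does not see `a`, the right half does not see `b`. The lines `τ
= 0, 1/2, 1` all give the meridian of the base point, and the bottom and top go to the poles. The
suspended map runs up the vertical line over the join coordinate `t`. Every such line deforms into
one zigzag: up the left side, along the top to the middle, down, along the bottom, up the right
side. Its image does not depend on `(a, b)`. The deformation must respect the gluing of the join at
`t = 0` and `t = 1`; `deform_left` and `deform_right` check this. The common path that remains is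
contracted to `north`.

`∇ ∘ (f ∨ g) ∘ W` differs from `f ·_w g` only by a constant path inserted between the two loops,
hence by a reparametrisation (`whiteheadComp_homotopic_genWhitehead`). The adjoint form used by
`σ_*` is homotopic to the ordinary suspension (`suspMap_homotopic_sigmaAdj`). With these, the claims
about Whitehead products follow from the first part for any inverse of `F`.

That `F` is an equivalence is proved by induction on `n`, in coordinates that place suspensions and
joins of spheres as unit spheres of gauges on vector spaces. Linear isomorphisms then give
homeomorphisms, and a homotopy only has to avoid the origin. For `n = 0` one cone of the join is
contracted and a rotation restores the base point (`joinToSusp_cupZero_isEquiv`). In the inductive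
step `F` is, up to homotopy, the suspension of the previous map composed with a coordinate shuffle
and a reflection (`joinToSusp_isEquiv_of_merid`). -/

namespace PtdHtpy

noncomputable section

/-! ### Homotopies on suspensions and joins. -/

section Homotopies

variable {A : PtdSpace.{u}} {B : PtdSpace.{v}} {C : PtdSpace.{w}}

/-- The path `push x` of the join. -/
def joinPush (x : A × B) : Path (Pushout.inl _ _ x.1 : join A B) (Pushout.inr _ _ x.2) :=
  Pushout.push (ContinuousMap.fst : C(A × B, A)) (ContinuousMap.snd : C(A × B, B)) x

theorem exists_eq_merid (z : susp A) : ∃ a t, z = merid a t :=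
  Pushout.ind (P := fun z : susp A => ∃ a t, z = merid a t)
    (fun _ => ⟨A.pt, 0, (merid _).source.symm⟩) (fun _ => ⟨A.pt, 1, (merid _).target.symm⟩)
    (fun a t => ⟨a, t, rfl⟩) z

theorem exists_eq_joinPush (z : join A B) : ∃ a b t, z = joinPush (a, b) t :=
  Pushout.ind (P := fun z : join A B => ∃ a b t, z = joinPush (a, b) t)
    (fun a => ⟨a, B.pt, 0, (joinPush (a, B.pt)).source.symm⟩)
    (fun b => ⟨A.pt, b, 1, (joinPush (A.pt, b)).target.symm⟩) (fun x t => ⟨x.1, x.2, t, rfl⟩) z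

/-- A map out of the join, given by a map on the cylinder that factors through the projections at
the two ends. -/
def joinLift {Z : Type*} [TopologicalSpace Z] (G : C((A × B) × I, Z))
    (hl : ∀ a b b', G ((a, b), 0) = G ((a, b'), 0))
    (hr : ∀ a a' b, G ((a, b), 1) = G ((a', b), 1)) : C(join A B, Z) :=
  joinDesc ⟨fun a => G ((a, B.pt), 0), by fun_prop⟩ ⟨fun b => G ((A.pt, b), 1), by fun_prop⟩
    (fun x => ⟨⟨fun t => G (x, t), by fun_prop⟩, hl _ _ _, hr _ _ _⟩) G.continuous

/-- Homotopies of maps out of a suspension, relative to the base point. -/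
theorem susp_homotopicRel {Z : Type*} [TopologicalSpace Z] {k₀ k₁ : C(susp A, Z)}
    (H : (A × I) × I → Z) (hH : Continuous H)
    (hn : ∀ a s, H ((a, 0), s) = k₀ north) (hs : ∀ a a' s, H ((a, 1), s) = H ((a', 1), s))
    (h0 : ∀ a t, H ((a, t), 0) = k₀ (merid a t)) (h1 : ∀ a t, H ((a, t), 1) = k₁ (merid a t)) :
    k₀.HomotopicRel k₁ {(susp A).pt} := by
  refine Pushout.homotopicRel_of _ (ContinuousMap.const _ (ContinuousMap.const _ (k₀ north)))
    (ContinuousMap.const _ ⟨fun s => H ((A.pt, 1), s), by fun_prop⟩)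
    (ContinuousMap.curry ⟨H, hH⟩) (fun a s => hn a s) (fun a s => hs _ _ s)
    (fun _ => rfl) (fun _ => ?_) h0 (fun _ => ?_) (fun _ => ?_) h1
    (fun z hz => .inl ⟨(), (Set.mem_singleton_iff.1 hz).symm, fun _ => rfl⟩)
  · exact (h0 A.pt 1).trans (congrArg k₀ (merid A.pt).target)
  · exact (hn A.pt 1).symm.trans ((h1 A.pt 0).trans (congrArg k₁ (merid A.pt).source))
  · exact (h1 A.pt 1).trans (congrArg k₁ (merid A.pt).target)

/-- Homotopies of maps out of a join, relative to the base point. -/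
theorem join_homotopicRel {Z : Type*} [TopologicalSpace Z] {k₀ k₁ : C(join A B, Z)}
    (H : ((A × B) × I) × I → Z) (hH : Continuous H)
    (hl : ∀ a b b' s, H (((a, b), 0), s) = H (((a, b'), 0), s))
    (hr : ∀ a a' b s, H (((a, b), 1), s) = H (((a', b), 1), s))
    (h0 : ∀ x t, H ((x, t), 0) = k₀ (joinPush x t))
    (h1 : ∀ x t, H ((x, t), 1) = k₁ (joinPush x t))
    (hpt : ∀ s, H (((A.pt, B.pt), 0), s) = k₀ (join A B).pt) :
    k₀.HomotopicRel k₁ {(join A B).pt} := by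
  refine Pushout.homotopicRel_of _
    (ContinuousMap.curry ⟨fun x : A × I => H (((x.1, B.pt), 0), x.2), by fun_prop⟩)
    (ContinuousMap.curry ⟨fun x : B × I => H (((A.pt, x.1), 1), x.2), by fun_prop⟩)
    (ContinuousMap.curry ⟨H, hH⟩) (fun a s => hl _ _ _ s) (fun a s => hr _ _ _ s)
    (fun a => ?_) (fun b => ?_) h0 (fun a => ?_) (fun b => ?_) h1
    (fun z hz => .inl ⟨A.pt, (Set.mem_singleton_iff.1 hz).symm, hpt⟩)
  · exact (h0 _ 0).trans (congrArg k₀ (joinPush (a, B.pt)).source)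
  · exact (h0 _ 1).trans (congrArg k₀ (joinPush (A.pt, b)).target)
  · exact (h1 _ 0).trans (congrArg k₁ (joinPush (a, B.pt)).source)
  · exact (h1 _ 1).trans (congrArg k₁ (joinPush (A.pt, b)).target)

theorem PMap.Homotopic.comp_right {f f' : PMap B C} (h : f.Homotopic f') (g : PMap A B) :
    (f.comp g).Homotopic (f'.comp g) := by
  obtain ⟨H⟩ := h
  refine ⟨⟨⟨⟨fun x => H (x.1, g.toMap x.2), by fun_prop⟩, fun z => H.apply_zero _,
    fun z => H.apply_one _⟩, ?_⟩⟩
  rintro s z hz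
  obtain rfl := Set.mem_singleton_iff.1 hz
  exact H.eq_fst s g.map_pt

theorem PMap.Homotopic.comp_left {f f' : PMap A B} (h : f.Homotopic f') (g : PMap B C) :
    (g.comp f).Homotopic (g.comp f') :=
  ContinuousMap.HomotopicRel.comp_continuousMap h g.toMap

/-- Suspending turns free homotopies into pointed ones. -/
theorem suspMap_homotopic {f g : PMap A B} (h : f.toMap.Homotopic g.toMap) :
    (suspMap f).Homotopic (suspMap g) := by
  obtain ⟨H⟩ := h
  -- Only the label of the meridian moves, so both poles stay fixed whatever `H` does to the base
  -- point.
  refine susp_homotopicRel (fun x : (A × I) × I => merid (H (x.2, x.1.1)) x.1.2)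
    (continuous_merid.comp (by fun_prop : Continuous
      fun x : (A × I) × I => (H (x.2, x.1.1), x.1.2)))
    (fun a s => (merid _).source) (fun a a' s => (merid _).target.trans (merid _).target.symm)
    (fun a t => ?_) (fun a t => ?_)
  · exact congrArg (fun y => merid y t) (H.apply_zero a)
  · exact congrArg (fun y => merid y t) (H.apply_one a)

theorem sigma_eq_merid_of_le (a : A) {t : I} (ht : (t : ℝ) ≤ 1 / 2) :
    sigma a t = merid a ⟨2 * t, by linarith [t.2.1], by linarith⟩ := by
  rw [sigma, Path.trans_apply, dif_pos ht]

theorem sigma_eq_merid_pt_of_ge (a : A) {t : I} (ht : 1 / 2 ≤ (t : ℝ)) :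
    sigma a t = merid A.pt ⟨2 - 2 * t, by linarith [t.2.2], by linarith⟩ := by
  rw [sigma, Path.trans_apply]
  split_ifs with h
  · have h2 : (t : ℝ) = 1 / 2 := le_antisymm h ht
    have e1 : (⟨2 * t, by linarith [t.2.1], by linarith⟩ : I) = 1 := Subtype.ext (by simp [h2])
    have e2 : (⟨2 - 2 * t, by linarith [t.2.2], by linarith⟩ : I) = 1 :=
      Subtype.ext (by norm_num [h2])
    rw [e1, e2, (merid a).target, (merid A.pt).target]
  · rw [Path.symm_apply]
    refine congrArg (merid A.pt) (Subtype.ext ?_)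
    change 1 - (2 * (t : ℝ) - 1) = 2 - 2 * t
    ring

/-- The time `t * (1 + s) / 2`: for `s` from `0` to `1` the traversed part of a concatenation of
two paths grows from its first half to all of it. -/
def growTime (t s : I) : I :=
  ⟨t * (1 + s) / 2, by have := t.2.1; have := s.2.1; positivity, by
    have := t.2.2; have := s.2.2; have := t.2.1; have := s.2.1; nlinarith⟩

@[fun_prop]
theorem continuous_growTime : Continuous fun x : I × I => growTime x.1 x.2 :=
  Continuous.subtype_mk (by fun_prop) _

theorem sigma_growTime_zero_left (a : A) (s : I) : sigma a (growTime 0 s) = north := by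
  have : growTime 0 s = 0 := Subtype.ext (by simp [growTime])
  rw [this, (sigma a).source]

theorem sigma_growTime_zero (a : A) (t : I) : sigma a (growTime t 0) = merid a t := by
  rw [sigma_eq_merid_of_le a (by simp [growTime]; linarith [t.2.2])]
  congr 1
  exact Subtype.ext (by simp [growTime]; ring)

theorem growTime_one (t : I) : growTime t 1 = t :=
  Subtype.ext (by simp [growTime]; ring)

theorem sigma_growTime_one_left (a : A) (s : I) :
    sigma a (growTime 1 s) = merid A.pt (unitInterval.symm s) := by
  rw [sigma_eq_merid_pt_of_ge a (by simp [growTime]; linarith [s.2.1])]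
  congr 1
  exact Subtype.ext (by simp [growTime]; ring)

/-- The first half of `σ` is the meridian itself. Letting the traversed part grow to all of `σ`
drags the image of `south` back to `north` along the meridian of the base point, independently of
the point of `A`. -/
theorem suspMap_homotopic_sigmaAdj (k : PMap A B) : (suspMap k).Homotopic (sigmaAdj k) := by
  refine susp_homotopicRel
    (fun x : (A × I) × I => sigma (k.toMap x.1.1) (growTime x.1.2 x.2))
    (continuous_sigma.comp (by fun_prop : Continuous
      fun x : (A × I) × I => (k.toMap x.1.1, growTime x.1.2 x.2)))
    (fun a s => ?_) (fun a a' s => ?_) (fun a t => ?_) (fun a t => ?_)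
  · exact sigma_growTime_zero_left _ s
  · exact (sigma_growTime_one_left _ s).trans (sigma_growTime_one_left _ s).symm
  · exact sigma_growTime_zero _ t
  · exact congrArg (sigma (k.toMap a)) (growTime_one t)

end Homotopies

/-! ### The two forms of the Whitehead map. -/

section Whitehead

variable {A : PtdSpace.{u}} {B : PtdSpace.{v}} {C : PtdSpace.{w}}

/-- The reparametrisation relating `(p · refl) · q` to `p · q`. -/
def skipTime (t : I) : I :=
  ⟨min (2 * t) (max (1 / 2) t), le_min (by linarith [t.2.1]) (le_max_of_le_left (by norm_num)),
    min_le_of_right_le (max_le (by norm_num) t.2.2)⟩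

theorem continuous_skipTime : Continuous skipTime := Continuous.subtype_mk (by fun_prop) _

/-- `skipTime` runs at double speed up to `1/2`, waits there until `t = 1/2`, and is the identity
afterwards. -/
theorem trans_refl_trans_apply {X : Type*} [TopologicalSpace X] {a b c : X} (p : Path a b)
    (q : Path b c) (t : I) :
    ((p.trans (Path.refl b)).trans q) t = (p.trans q) (skipTime t) := by
  have ht0 := t.2.1
  have ht1 := t.2.2
  simp only [Path.trans_apply, Path.refl_apply]
  by_cases h : (t : ℝ) ≤ 1 / 2
  · rw [dif_pos h]
    by_cases h4 : 2 * (t : ℝ) ≤ 1 / 2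
    · have e : (skipTime t : ℝ) = 2 * t := min_eq_left (le_max_of_le_left h4)
      rw [dif_pos h4, dif_pos (by rw [e]; exact h4)]
      congr 1
      exact Subtype.ext (by simp [e])
    · have e : (skipTime t : ℝ) = 1 / 2 := by
        change min (2 * (t : ℝ)) (max (1 / 2) t) = 1 / 2
        rw [max_eq_left h, min_eq_right (not_le.1 h4).le]
      rw [dif_neg h4, dif_pos e.le]
      have : (⟨2 * (skipTime t : ℝ), by rw [e]; norm_num, by rw [e]; norm_num⟩ : I) = 1 :=
        Subtype.ext (by simp [e])
      rw [this, p.target]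
  · have e : (skipTime t : ℝ) = t := by
      change min (2 * (t : ℝ)) (max (1 / 2) t) = t
      rw [max_eq_right (not_le.1 h).le, min_eq_right (by linarith)]
    rw [dif_neg h, dif_neg (by rw [e]; exact h)]
    congr 1
    exact Subtype.ext (by simp [e])

/-- The fold map makes the connecting path of the wedge constant, which leaves `(p · refl) · q`. -/
theorem whiteheadComp_push (f : PMap (susp A) C) (g : PMap (susp B) C) (x : A × B) (t : I) :
    (whiteheadComp f g).toMap (joinPush x t) = genWhiteheadPath f g x (skipTime t) := by
  rw [genWhiteheadPath, ← trans_refl_trans_apply]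
  change ((fold C).comp (wedgeMap f g)) (whiteheadPath x t) = _
  refine (congrArg _ (Path.trans_apply _ _ t)).trans (Eq.trans ?_ (Path.trans_apply _ _ t).symm)
  split_ifs
  · refine (congrArg _ (Path.trans_apply _ _ _)).trans (Eq.trans ?_ (Path.trans_apply _ _ _).symm)
    split_ifs <;> rfl
  · rfl

/-- The affine path from `t` to `r`, at time `s`. -/
def lineTime (t r s : I) : I :=
  ⟨(1 - s) * t + s * r, by
    have := t.2.1; have := s.2.1; have := r.2.1; have := sub_nonneg.2 s.2.2; positivity, by
    have := t.2.2; have := s.2.1; have := r.2.2; have := s.2.2; nlinarith⟩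

@[fun_prop]
theorem continuous_lineTime : Continuous fun x : I × I × I => lineTime x.1 x.2.1 x.2.2 :=
  Continuous.subtype_mk (by fun_prop) _

/-- `skipTime` fixes `0` and `1`, so its straight-line homotopy to the identity of `I` respects both
ends of the join. -/
theorem whiteheadComp_homotopic_genWhitehead (f : PMap (susp A) C) (g : PMap (susp B) C) :
    (whiteheadComp f g).Homotopic (genWhitehead f g) := by
  have h0 : ∀ s, lineTime (skipTime 0) 0 s = 0 := fun s =>
    Subtype.ext (by simp [lineTime, skipTime])
  have h1 : ∀ s, lineTime (skipTime 1) 1 s = 1 := fun s =>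
    Subtype.ext (by norm_num [lineTime, skipTime])
  have := continuous_skipTime
  refine join_homotopicRel
    (fun x : ((A × B) × I) × I => genWhiteheadPath f g x.1.1 (lineTime (skipTime x.1.2) x.1.2 x.2))
    ((continuous_genWhiteheadPath f g).comp (by fun_prop : Continuous
      fun x : ((A × B) × I) × I => (x.1.1, lineTime (skipTime x.1.2) x.1.2 x.2)))
    (fun a b b' s => ?_) (fun a a' b s => ?_) (fun x t => ?_) (fun x t => ?_) (fun s => ?_)
  · simp only [h0, Path.source]
  · simp only [h1, Path.target]
  · rw [whiteheadComp_push]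
    congr 1
    exact Subtype.ext (by simp [lineTime])
  · change _ = genWhiteheadPath f g x t
    congr 1
    exact Subtype.ext (by simp [lineTime])
  · simp only [h0, Path.source]
    exact (whiteheadComp f g).map_pt.symm

/-! ### The Eckmann–Hilton square. -/

/-- The suspension of a map is null if the meridians through its values can be deformed, uniformly
and with fixed ends, to a single path. -/
theorem suspMap_homotopic_const {h : PMap A C} (H : C(A, C(I × I, susp C)))
    (h0 : ∀ a u, H a (0, u) = merid (h.toMap a) u) (hn : ∀ a s, H a (s, 0) = north)
    (hs : ∀ a s, H a (s, 1) = south) (h1 : ∀ a a' u, H a (1, u) = H a' (1, u)) :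
    (suspMap h).Homotopic (PMap.const (susp A) (susp C)) := by
  let k : C(susp A, susp C) := suspDesc north south
    (fun _ => ⟨⟨fun u => H A.pt (1, u), by fun_prop⟩, hn _ _, hs _ _⟩)
    (by exact (by fun_prop : Continuous fun x : A × I => H A.pt (1, x.2)))
  have hk : ∀ a u, k (merid a u) = H A.pt (1, u) := fun _ _ => rfl
  have e1 : (suspMap h).toMap.HomotopicRel k {(susp A).pt} := by
    refine susp_homotopicRel (fun x : (A × I) × I => H x.1.1 (x.2, x.1.2)) (by fun_prop)
      (fun a s => ?_) (fun a a' s => ?_) (fun a t => ?_) (fun a t => ?_)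
    · exact hn _ _
    · exact (hs _ _).trans (hs _ _).symm
    · exact h0 _ _
    · exact h1 _ _ _
  -- All meridians now follow one path starting at `north`. It is shrunk to its start, the image of
  -- `south` being free to move.
  have e2 : k.HomotopicRel (PMap.const (susp A) (susp C)).toMap {(susp A).pt} := by
    refine susp_homotopicRel
      (fun x : (A × I) × I => H A.pt (1, x.1.2 * unitInterval.symm x.2)) (by fun_prop)
      (fun a s => ?_) (fun a a' s => rfl) (fun a t => ?_) (fun a t => ?_)
    · exact (by simp : H A.pt (1, 0 * unitInterval.symm s) = H A.pt (1, 0)).trans (hn _ _)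
    · simp [hk]
    · exact (by simp : H A.pt (1, t * unitInterval.symm 1) = H A.pt (1, 0)).trans (hn _ _)
  exact e1.trans e2

theorem genWhiteheadPath_of_le_zero (f : PMap (susp A) C) (g : PMap (susp B) C) (x : A × B)
    {τ : ℝ} (h : τ ≤ 0) :
    genWhiteheadPath f g x (Set.projIcc 0 1 zero_le_one τ) = C.pt := by
  rw [Set.projIcc_of_le_left _ h]
  exact (genWhiteheadPath f g x).source

theorem genWhiteheadPath_of_one_le (f : PMap (susp A) C) (g : PMap (susp B) C) (x : A × B)
    {τ : ℝ} (h : 1 ≤ τ) :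
    genWhiteheadPath f g x (Set.projIcc 0 1 zero_le_one τ) = C.pt := by
  rw [Set.projIcc_of_right_le _ h]
  exact (genWhiteheadPath f g x).target

/-- The first half of the path is the loop of `g`, which does not involve the point of `A`. -/
theorem genWhiteheadPath_of_le_half (f : PMap (susp A) C) (g : PMap (susp B) C) (a a' : A) (b : B)
    {τ : ℝ} (h : τ ≤ 1 / 2) :
    genWhiteheadPath f g (a, b) (Set.projIcc 0 1 zero_le_one τ) =
      genWhiteheadPath f g (a', b) (Set.projIcc 0 1 zero_le_one τ) := by
  have : ((Set.projIcc 0 1 zero_le_one τ : I) : ℝ) ≤ 1 / 2 := by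
    rw [Set.coe_projIcc]
    exact max_le (by norm_num) (min_le_of_right_le h)
  simp only [genWhiteheadPath, Path.trans_apply, dif_pos this]

theorem genWhiteheadPath_of_half_le (f : PMap (susp A) C) (g : PMap (susp B) C) (a : A) (b b' : B)
    {τ : ℝ} (h : 1 / 2 ≤ τ) :
    genWhiteheadPath f g (a, b) (Set.projIcc 0 1 zero_le_one τ) =
      genWhiteheadPath f g (a, b') (Set.projIcc 0 1 zero_le_one τ) := by
  have : 1 / 2 ≤ ((Set.projIcc 0 1 zero_le_one τ : I) : ℝ) := by
    rw [Set.coe_projIcc]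
    exact le_max_of_le_right (le_min (by norm_num) h)
  simp only [genWhiteheadPath, Path.trans_apply]
  split_ifs with h'
  -- At exactly `1/2` the concatenation still uses its first branch, whose endpoint is the base
  -- point for both `b` and `b'`.
  · have e : (⟨2 * ((Set.projIcc 0 1 zero_le_one τ : I) : ℝ), by linarith, by linarith⟩ : I) = 1 :=
      Subtype.ext (by simp only [Set.Icc.coe_one]; linarith)
    rw [e, Path.target, Path.target]
  · rfl

theorem genWhiteheadPath_half (f : PMap (susp A) C) (g : PMap (susp B) C) (x : A × B)
    {τ : ℝ} (h : τ = 1 / 2) :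
    genWhiteheadPath f g x (Set.projIcc 0 1 zero_le_one τ) = C.pt := by
  have e : ((Set.projIcc 0 1 zero_le_one τ : I) : ℝ) = 1 / 2 := by
    rw [Set.coe_projIcc, h]
    norm_num
  simp only [genWhiteheadPath, Path.trans_apply, dif_pos e.le]
  have e : (⟨2 * ((Set.projIcc 0 1 zero_le_one τ : I) : ℝ), by linarith, by linarith⟩ : I) = 1 :=
    Subtype.ext (by simp [e])
  rw [e, Path.target]

theorem merid_eq_north {c : C} {φ : ℝ} (h : φ ≤ 0) :
    merid c (Set.projIcc 0 1 zero_le_one φ) = north := by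
  rw [Set.projIcc_of_le_left _ h]
  exact (merid c).source

theorem merid_eq_south {c : C} {φ : ℝ} (h : 1 ≤ φ) :
    merid c (Set.projIcc 0 1 zero_le_one φ) = south := by
  rw [Set.projIcc_of_right_le _ h]
  exact (merid c).target

/-- The horizontal component of the zigzag in the Eckmann–Hilton square: it runs along the top side
to the middle, waits there, and runs on along the bottom side. -/
def zigzagBase (u : ℝ) : ℝ := max (min ((9 * u - 3) / 2) (1 / 2)) ((9 * u - 4) / 2)

/-- The vertical component of the zigzag: up, down in the middle, up again. -/
def zigzagHeight (u : ℝ) : ℝ := max (min (3 * u) (5 - 9 * u)) (3 * u - 2)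

/-- The horizontal component of the deformation of vertical lines into the zigzag. -/
def deformBase (t s u : ℝ) : ℝ :=
  (1 - max 0 (min 1 (3 * s - 1))) * t + max 0 (min 1 (3 * s - 1)) * zigzagBase u

/-- The vertical component of the deformation of vertical lines into the zigzag. -/
def deformHeight (t s u : ℝ) : ℝ :=
  (1 - max 0 (3 * s - 2)) * ((1 - min 1 (3 * s)) * u + min 1 (3 * s) * (3 * u - 2 * t)) +
    max 0 (3 * s - 2) * zigzagHeight u

/-- Each alternative makes the value at the `inl` end independent of `b`. The stages `s ≤ 1/3`, `1/3
≤ s ≤ 2/3`, `2/3 ≤ s` adjust the speed, the base and the height in turn. For `t = 0` the first stage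
compresses the climb into `u ≤ 1/3`. Hence `south` is already reached when the base later crosses
the half belonging to `g`, during `1/3 < u < 4/9`. -/
theorem deform_left {s u : ℝ} (hs1 : s ≤ 1) :
    deformBase 0 s u ≤ 0 ∨ 1 / 2 ≤ deformBase 0 s u ∨ 1 ≤ deformHeight 0 s u := by
  rcases le_total s (1 / 3) with h | h
  · left
    rw [deformBase, max_eq_left (min_le_of_right_le (by linarith))]
    simp
  have e1 : min 1 (3 * s) = 1 := min_eq_left (by linarith)
  rcases le_total u (1 / 3) with hu | hu
  · left
    have : zigzagBase u ≤ 0 := max_le (min_le_of_left_le (by linarith)) (by linarith)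
    have h' : 0 ≤ max 0 (min 1 (3 * s - 1)) := le_max_left _ _
    rw [deformBase]
    nlinarith
  rcases le_total u (4 / 9) with hu' | hu'
  · right; right
    have : 1 ≤ zigzagHeight u := le_max_of_le_left (le_min (by linarith) (by linarith))
    have h' : 0 ≤ max 0 (3 * s - 2) := le_max_left _ _
    have h'' : max 0 (3 * s - 2) ≤ 1 := max_le zero_le_one (by linarith)
    rw [deformHeight, e1]
    nlinarith
  rcases le_total s (2 / 3) with h2 | h2
  · right; right
    rw [deformHeight, e1, max_eq_left (by linarith)]
    linarith
  · right; left
    have : 1 / 2 ≤ zigzagBase u := le_max_of_le_left (le_min (by linarith) le_rfl)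
    rw [deformBase, min_eq_left (by linarith), max_eq_right zero_le_one]
    linarith

/-- The mirror image: for `t = 1` the climb is delayed to `u ≥ 2/3`, so the half belonging to `f` is
crossed at `north`, during `5/9 < u < 2/3`. -/
theorem deform_right {s u : ℝ} (hs1 : s ≤ 1) :
    1 ≤ deformBase 1 s u ∨ deformBase 1 s u ≤ 1 / 2 ∨ deformHeight 1 s u ≤ 0 := by
  rcases le_total s (1 / 3) with h | h
  · left
    rw [deformBase, max_eq_left (min_le_of_right_le (by linarith))]
    simp
  have e1 : min 1 (3 * s) = 1 := min_eq_left (by linarith)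
  rcases le_total (2 / 3) u with hu | hu
  · left
    have : 1 ≤ zigzagBase u := le_max_of_le_right (by linarith)
    have h' : 0 ≤ max 0 (min 1 (3 * s - 1)) := le_max_left _ _
    rw [deformBase]
    nlinarith
  rcases le_total (5 / 9) u with hu' | hu'
  · right; right
    have : zigzagHeight u ≤ 0 := max_le (min_le_of_right_le (by linarith)) (by linarith)
    have h' : 0 ≤ max 0 (3 * s - 2) := le_max_left _ _
    have h'' : max 0 (3 * s - 2) ≤ 1 := max_le zero_le_one (by linarith)
    rw [deformHeight, e1]
    nlinarith
  rcases le_total s (2 / 3) with h2 | h2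
  · right; right
    rw [deformHeight, e1, max_eq_left (by linarith)]
    linarith
  · right; left
    have : zigzagBase u ≤ 1 / 2 := max_le (min_le_right _ _) (by linarith)
    rw [deformBase, min_eq_left (by linarith), max_eq_right zero_le_one]
    linarith

/-- An inequality suffices, because heights are clamped to `[0, 1]` before they are used. -/
theorem deformHeight_zero {t s : ℝ} (ht : 0 ≤ t) (hs0 : 0 ≤ s) (hs1 : s ≤ 1) :
    deformHeight t s 0 ≤ 0 := by
  have hz : zigzagHeight 0 = 0 := by norm_num [zigzagHeight]
  have h' : 0 ≤ max 0 (3 * s - 2) := le_max_left _ _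
  have h'' : max 0 (3 * s - 2) ≤ 1 := max_le zero_le_one (by linarith)
  have h3 : 0 ≤ min 1 (3 * s) := le_min zero_le_one (by linarith)
  rw [deformHeight, hz]
  have : 0 ≤ (1 - max 0 (3 * s - 2)) * (min 1 (3 * s) * (2 * t)) :=
    mul_nonneg (by linarith) (by positivity)
  linarith

theorem deformHeight_one {t s : ℝ} (ht : t ≤ 1) (hs0 : 0 ≤ s) (hs1 : s ≤ 1) :
    1 ≤ deformHeight t s 1 := by
  have hz : zigzagHeight 1 = 1 := by norm_num [zigzagHeight]
  have h' : 0 ≤ max 0 (3 * s - 2) := le_max_left _ _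
  have h'' : max 0 (3 * s - 2) ≤ 1 := max_le zero_le_one (by linarith)
  have h3 : 0 ≤ min 1 (3 * s) := le_min zero_le_one (by linarith)
  rw [deformHeight, hz]
  have : 0 ≤ (1 - max 0 (3 * s - 2)) * (min 1 (3 * s) * (2 * (1 - t))) :=
    mul_nonneg (by linarith) (mul_nonneg h3 (by linarith))
  linarith

/-- The zigzag stays on the grid lines, where the square takes values independent of the loops. -/
theorem zigzag_cases (u : ℝ) : zigzagBase u ≤ 0 ∨ zigzagBase u = 1 / 2 ∨ 1 ≤ zigzagBase u ∨
    zigzagHeight u ≤ 0 ∨ 1 ≤ zigzagHeight u := by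
  rcases le_total u (1 / 3) with hu | hu
  · exact .inl (max_le (min_le_of_left_le (by linarith)) (by linarith))
  rcases le_total u (4 / 9) with hu' | hu'
  · exact .inr (.inr (.inr (.inr (le_max_of_le_left (le_min (by linarith) (by linarith))))))
  rcases le_total u (5 / 9) with h5 | h5
  · exact .inr (.inl (by rw [zigzagBase, min_eq_right (by linarith), max_eq_left (by linarith)]))
  rcases le_total u (2 / 3) with h6 | h6
  · exact .inr (.inr (.inr (.inl (max_le (min_le_of_right_le (by linarith)) (by linarith)))))
  · exact .inr (.inr (.inl (le_max_of_le_right (by linarith))))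

/-- The suspension of a generalised Whitehead map is null, by the Eckmann–Hilton argument. -/
theorem suspMap_genWhitehead_homotopic_const (f : PMap (susp A) C) (g : PMap (susp B) C) :
    (suspMap (genWhitehead f g)).Homotopic (PMap.const (susp (join A B)) (susp C)) := by
  let pr : ℝ → I := Set.projIcc 0 1 zero_le_one
  have hpr : Continuous pr := continuous_projIcc
  let E : ((A × B) × I) × I × I → susp C := fun y =>
    merid (genWhiteheadPath f g y.1.1 (pr (deformBase y.1.2 y.2.1 y.2.2)))
      (pr (deformHeight y.1.2 y.2.1 y.2.2))
  have hbase : Continuous fun y : ((A × B) × I) × I × I =>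
      pr (deformBase y.1.2 y.2.1 y.2.2) := by
    refine hpr.comp ?_
    unfold deformBase zigzagBase
    fun_prop
  have hheight : Continuous fun y : ((A × B) × I) × I × I =>
      pr (deformHeight y.1.2 y.2.1 y.2.2) := by
    refine hpr.comp ?_
    unfold deformHeight zigzagHeight
    fun_prop
  have hE : Continuous E :=
    continuous_merid.comp (((continuous_genWhiteheadPath f g).comp
      ((continuous_fst.comp continuous_fst).prodMk hbase)).prodMk hheight)
  have hl : ∀ a b b', ContinuousMap.curry ⟨E, hE⟩ ((a, b), 0) =
      ContinuousMap.curry ⟨E, hE⟩ ((a, b'), 0) := by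
    intro a b b'
    ext ⟨s, u⟩
    change merid (genWhiteheadPath f g (a, b) (pr (deformBase 0 s u))) (pr (deformHeight 0 s u)) =
      merid (genWhiteheadPath f g (a, b') (pr (deformBase 0 s u))) (pr (deformHeight 0 s u))
    rcases deform_left (u := u) s.2.2 with h | h | h
    · rw [genWhiteheadPath_of_le_zero f g _ h, genWhiteheadPath_of_le_zero f g _ h]
    · rw [genWhiteheadPath_of_half_le f g a b b' h]
    · rw [merid_eq_south h, merid_eq_south h]
  have hr : ∀ a a' b, ContinuousMap.curry ⟨E, hE⟩ ((a, b), 1) =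
      ContinuousMap.curry ⟨E, hE⟩ ((a', b), 1) := by
    intro a a' b
    ext ⟨s, u⟩
    change merid (genWhiteheadPath f g (a, b) (pr (deformBase 1 s u))) (pr (deformHeight 1 s u)) =
      merid (genWhiteheadPath f g (a', b) (pr (deformBase 1 s u))) (pr (deformHeight 1 s u))
    rcases deform_right (u := u) s.2.2 with h | h | h
    · rw [genWhiteheadPath_of_one_le f g _ h, genWhiteheadPath_of_one_le f g _ h]
    · rw [genWhiteheadPath_of_le_half f g a a' b h]
    · rw [merid_eq_north h, merid_eq_north h]
  have hpush : ∀ x t y, joinLift (ContinuousMap.curry ⟨E, hE⟩) hl hr (joinPush x t) y =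
      E ((x, t), y) := fun _ _ _ => rfl
  refine suspMap_homotopic_const (joinLift (ContinuousMap.curry ⟨E, hE⟩) hl hr)
    (fun z u => ?_) (fun z s => ?_) (fun z s => ?_) (fun z z' u => ?_)
  · obtain ⟨a, b, t, rfl⟩ := exists_eq_joinPush z
    have e1 : pr (deformBase t (0 : I) u) = t := by
      have : deformBase t (0 : I) u = t := by norm_num [deformBase]
      rw [this]
      exact Set.projIcc_val _ t
    have e2 : pr (deformHeight t (0 : I) u) = u := by
      have : deformHeight t (0 : I) u = u := by norm_num [deformHeight]
      rw [this]
      exact Set.projIcc_val _ u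
    rw [hpush]
    change merid (genWhiteheadPath f g (a, b) (pr (deformBase t (0 : I) u)))
      (pr (deformHeight t (0 : I) u)) = _
    rw [e1, e2]
    rfl
  · obtain ⟨a, b, t, rfl⟩ := exists_eq_joinPush z
    exact merid_eq_north (deformHeight_zero t.2.1 s.2.1 s.2.2)
  · obtain ⟨a, b, t, rfl⟩ := exists_eq_joinPush z
    exact merid_eq_south (deformHeight_one t.2.2 s.2.1 s.2.2)
  -- On the vertical grid lines the loop is at the base point; on the horizontal ones the meridian
  -- is at a pole, so its label is irrelevant.
  · have key : ∀ z, joinLift (ContinuousMap.curry ⟨E, hE⟩) hl hr z (1, u) =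
        merid C.pt (pr (zigzagHeight u)) := by
      intro z
      obtain ⟨a, b, t, rfl⟩ := exists_eq_joinPush z
      rw [hpush]
      have e1 : deformBase t (1 : I) u = zigzagBase u := by norm_num [deformBase]
      have e2 : deformHeight t (1 : I) u = zigzagHeight u := by norm_num [deformHeight]
      change merid (genWhiteheadPath f g (a, b) (pr (deformBase t (1 : I) u)))
        (pr (deformHeight t (1 : I) u)) = _
      rw [e1, e2]
      rcases zigzag_cases u with h | h | h | h | h
      · rw [genWhiteheadPath_of_le_zero f g _ h]
      · rw [genWhiteheadPath_half f g _ h]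
      · rw [genWhiteheadPath_of_one_le f g _ h]
      · rw [merid_eq_north h, merid_eq_north h]
      · rw [merid_eq_south h, merid_eq_south h]
    rw [key, key]

end Whitehead

end

end PtdHtpy

namespace PtdHtpy

noncomputable section

/-! ## Coordinates on spheres -/

/-- Coordinates identifying `X` with the unit sphere of a gauge on a normed space. -/
structure SphereModel (X : Type*) [TopologicalSpace X] (V : Type*) [NormedAddCommGroup V]
    [NormedSpace ℝ V] where
  gauge : V → ℝ
  continuous_gauge : Continuous gauge
  gauge_smul : ∀ r : ℝ, 0 ≤ r → ∀ v, gauge (r • v) = r * gauge v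
  gauge_pos : ∀ v, v ≠ 0 → 0 < gauge v
  vec : C(X, V)
  gauge_vec : ∀ x, gauge (vec x) = 1
  injective_vec : Function.Injective vec
  exists_vec_eq : ∀ v, gauge v = 1 → ∃ x, vec x = v

namespace SphereModel

section Basic

variable {X V Y W : Type*} [TopologicalSpace X] [TopologicalSpace Y]
  [NormedAddCommGroup V] [NormedSpace ℝ V] [NormedAddCommGroup W] [NormedSpace ℝ W]
  (M : SphereModel X V) (N : SphereModel Y W)

theorem gauge_zero : M.gauge 0 = 0 := by
  have := M.gauge_smul 0 le_rfl 0
  rwa [zero_smul, zero_mul] at this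

theorem gauge_nonneg (v : V) : 0 ≤ M.gauge v := by
  by_cases h : v = 0
  · rw [h, M.gauge_zero]
  · exact (M.gauge_pos v h).le

theorem gauge_eq_zero {v : V} (h : M.gauge v = 0) : v = 0 := by
  by_contra hv
  exact (M.gauge_pos v hv).ne' h

theorem vec_ne_zero (x : X) : M.vec x ≠ 0 := fun h => by
  have := M.gauge_vec x
  rw [h, M.gauge_zero] at this
  exact zero_ne_one this

theorem gauge_smul_vec {r : ℝ} (hr : 0 ≤ r) (x : X) : M.gauge (r • M.vec x) = r := by
  rw [M.gauge_smul r hr, M.gauge_vec, mul_one]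

theorem exists_vec_eq_smul (v : {v : V // v ≠ 0}) : ∃ x, M.vec x = (M.gauge v)⁻¹ • (v : V) := by
  have h := M.gauge_pos v v.2
  exact M.exists_vec_eq _ (by rw [M.gauge_smul _ (inv_nonneg.2 h.le), inv_mul_cancel₀ h.ne'])

/-- The radial retraction onto the sphere. -/
def retr (v : {v : V // v ≠ 0}) : X := (M.exists_vec_eq_smul v).choose

theorem vec_retr (v : {v : V // v ≠ 0}) : M.vec (M.retr v) = (M.gauge v)⁻¹ • (v : V) :=
  (M.exists_vec_eq_smul v).choose_spec

theorem retr_eq {v : {v : V // v ≠ 0}} {x : X} {r : ℝ} (hr : 0 < r)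
    (h : (v : V) = r • M.vec x) : M.retr v = x := by
  apply M.injective_vec
  rw [M.vec_retr, h, M.gauge_smul_vec hr.le, inv_smul_smul₀ hr.ne']

/-- By compactness `vec` is a closed embedding, so continuity may be tested on coordinates, where
the retraction is division by the gauge. -/
theorem continuous_retr [CompactSpace X] : Continuous M.retr := by
  have hM := (M.vec.continuous.isClosedEmbedding M.injective_vec).isInducing
  rw [hM.continuous_iff]
  have : M.vec ∘ M.retr = fun v : {v : V // v ≠ 0} => (M.gauge v)⁻¹ • (v : V) :=
    funext M.vec_retr
  rw [this]
  have h := M.continuous_gauge.comp (continuous_subtype_val (p := fun v : V => v ≠ 0))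
  exact (h.inv₀ fun v => by exact (M.gauge_pos v v.2).ne').smul continuous_subtype_val

/-- Two maps to a sphere are homotopic if their coordinates can be joined by a homotopy avoiding
the origin. -/
theorem homotopicRel [CompactSpace X] {Z : Type*} [TopologicalSpace Z] {f g : C(Z, X)} {S : Set Z}
    (H : I × Z → V) (hc : Continuous H) (hne : ∀ p, H p ≠ 0)
    (h0 : ∀ z, H (0, z) = M.vec (f z)) (h1 : ∀ z, ∃ r : ℝ, 0 < r ∧ H (1, z) = r • M.vec (g z))
    (hS : ∀ z ∈ S, ∀ s, ∃ r : ℝ, 0 < r ∧ H (s, z) = r • M.vec (f z)) : f.HomotopicRel g S := by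
  refine ⟨⟨⟨⟨fun p => M.retr ⟨H p, hne p⟩, M.continuous_retr.comp (hc.subtype_mk _)⟩,
    fun z => ?_, fun z => ?_⟩, fun s z hz => ?_⟩⟩
  · exact M.retr_eq one_pos ((h0 z).trans (one_smul _ _).symm)
  · obtain ⟨r, hr, h⟩ := h1 z
    exact M.retr_eq hr h
  · obtain ⟨r, hr, h⟩ := hS z hz s
    exact M.retr_eq hr h

/-- The map of spheres induced by a linear equivalence. -/
def linMap (L : V ≃L[ℝ] W) (x : X) : Y :=
  N.retr ⟨L (M.vec x), fun h => M.vec_ne_zero x (L.map_eq_zero_iff.1 h)⟩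

theorem linMap_eq {L : V ≃L[ℝ] W} {x : X} {y : Y} {r : ℝ} (hr : 0 < r)
    (h : L (M.vec x) = r • N.vec y) : M.linMap N L x = y :=
  N.retr_eq hr h

theorem continuous_linMap [CompactSpace Y] (L : V ≃L[ℝ] W) : Continuous (M.linMap N L) :=
  N.continuous_retr.comp ((L.continuous.comp M.vec.continuous).subtype_mk _)

theorem vec_linMap (L : V ≃L[ℝ] W) (x : X) :
    N.vec (M.linMap N L x) = (N.gauge (L (M.vec x)))⁻¹ • L (M.vec x) :=
  N.vec_retr _

theorem vec_linMap_of_gauge {L : V ≃L[ℝ] W} (hL : ∀ v, N.gauge (L v) = M.gauge v) (x : X) :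
    N.vec (M.linMap N L x) = L (M.vec x) := by
  rw [vec_linMap, hL, M.gauge_vec, inv_one, one_smul]

theorem linMap_symm_linMap (L : V ≃L[ℝ] W) (x : X) :
    N.linMap M L.symm (M.linMap N L x) = x := by
  have h : 0 < N.gauge (L (M.vec x)) :=
    N.gauge_pos _ fun h => M.vec_ne_zero x (L.map_eq_zero_iff.1 h)
  refine N.linMap_eq M (inv_pos.2 h) ?_
  rw [vec_linMap, map_smul, L.symm_apply_apply]

/-- The homeomorphism of spheres induced by a linear equivalence. -/
def linHomeo [CompactSpace X] [CompactSpace Y] (L : V ≃L[ℝ] W) : X ≃ₜ Y where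
  toFun := M.linMap N L
  invFun := N.linMap M L.symm
  left_inv := M.linMap_symm_linMap N L
  right_inv y := by simpa using N.linMap_symm_linMap M L.symm y
  continuous_toFun := M.continuous_linMap N L
  continuous_invFun := N.continuous_linMap M L.symm

end Basic

/-- The two points `±1` of the line. -/
def bool : SphereModel Bool ℝ where
  gauge v := |v|
  continuous_gauge := continuous_abs
  gauge_smul r hr v := by rw [smul_eq_mul, abs_mul, abs_of_nonneg hr]
  gauge_pos v hv := abs_pos.2 hv
  vec := ⟨fun b => if b then 1 else -1, continuous_of_discreteTopology⟩
  gauge_vec b := by cases b <;> simp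
  injective_vec := by
    intro a b h
    cases a <;> cases b <;> first | rfl | norm_num at h
  exists_vec_eq v hv := by
    rcases (abs_eq zero_le_one).1 hv with rfl | rfl
    exacts [⟨true, rfl⟩, ⟨false, rfl⟩]

section Susp

variable {X : PtdSpace.{u}} {V : Type*} [NormedAddCommGroup V] [NormedSpace ℝ V]
  (M : SphereModel X V)

/-- The coordinates of the suspension. -/
def suspVec : C(PtdHtpy.susp X, V × ℝ) :=
  suspDesc (0, -1) (0, 1)
    (fun x => ⟨⟨fun t => ((1 - |2 * (t : ℝ) - 1|) • M.vec x, 2 * (t : ℝ) - 1), by fun_prop⟩,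
      by norm_num, by norm_num⟩)
    (by exact (by fun_prop : Continuous fun x : X × I =>
      ((1 - |2 * (x.2 : ℝ) - 1|) • M.vec x.1, 2 * (x.2 : ℝ) - 1)))

theorem suspVec_merid (x : X) (t : I) :
    M.suspVec (merid x t) = ((1 - |2 * (t : ℝ) - 1|) • M.vec x, 2 * (t : ℝ) - 1) := rfl

theorem one_sub_abs_nonneg (t : I) : 0 ≤ 1 - |2 * (t : ℝ) - 1| := by
  have := t.2.1
  have := t.2.2
  have : |2 * (t : ℝ) - 1| ≤ 1 := abs_le.2 ⟨by linarith, by linarith⟩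
  linarith

theorem eq_of_one_sub_abs_eq_zero {t : I} (h : 1 - |2 * (t : ℝ) - 1| = 0) : t = 0 ∨ t = 1 := by
  rcases (abs_eq zero_le_one).1 (sub_eq_zero.1 h).symm with h | h
  · exact .inr (Subtype.ext (by simp only [Set.Icc.coe_one]; linarith))
  · exact .inl (Subtype.ext (by simp only [Set.Icc.coe_zero]; linarith))

/-- The suspension of a sphere is a sphere. -/
def susp : SphereModel (PtdHtpy.susp X) (V × ℝ) where
  gauge v := M.gauge v.1 + |v.2|
  continuous_gauge := (M.continuous_gauge.comp continuous_fst).add continuous_snd.abs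
  gauge_smul r hr v := by
    simp only [Prod.smul_fst, Prod.smul_snd, M.gauge_smul r hr, smul_eq_mul, abs_mul,
      abs_of_nonneg hr]
    ring
  gauge_pos v hv := by
    have h1 := M.gauge_nonneg v.1
    have h2 := abs_nonneg v.2
    by_contra h
    exact hv (Prod.ext (M.gauge_eq_zero (by linarith)) (abs_eq_zero.1 (by linarith)))
  vec := M.suspVec
  gauge_vec z := by
    obtain ⟨x, t, rfl⟩ := exists_eq_merid z
    rw [suspVec_merid, M.gauge_smul_vec (one_sub_abs_nonneg t)]
    ring
  injective_vec := by
    intro z z' h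
    obtain ⟨x, t, rfl⟩ := exists_eq_merid z
    obtain ⟨x', t', rfl⟩ := exists_eq_merid z'
    rw [suspVec_merid, suspVec_merid, Prod.mk.injEq] at h
    obtain ⟨h1, h2⟩ := h
    obtain rfl : t = t' := Subtype.ext (by linarith)
    by_cases ht : 1 - |2 * (t : ℝ) - 1| = 0
    · rcases eq_of_one_sub_abs_eq_zero ht with rfl | rfl
      · exact (merid x).source.trans (merid x').source.symm
      · exact (merid x).target.trans (merid x').target.symm
    · rw [M.injective_vec (smul_right_injective V ht h1)]
  exists_vec_eq := by
    rintro ⟨v, h⟩ hv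
    change M.gauge v + |h| = 1 at hv
    have hv0 := M.gauge_nonneg v
    obtain ⟨h1, h2⟩ := abs_le.1 (by linarith : |h| ≤ 1)
    let t : I := ⟨(h + 1) / 2, by linarith, by linarith⟩
    have ht : 2 * (t : ℝ) - 1 = h := by simp only [t]; ring
    by_cases hv' : v = 0
    · refine ⟨merid X.pt t, ?_⟩
      rw [hv', M.gauge_zero, zero_add] at hv
      rw [suspVec_merid, ht, hv, hv', sub_self, zero_smul]
    · refine ⟨merid (M.retr ⟨v, hv'⟩) t, ?_⟩
      have : 1 - |h| = M.gauge v := by linarith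
      rw [suspVec_merid, ht, M.vec_retr, this, smul_inv_smul₀ (M.gauge_pos v hv').ne']

theorem susp_vec_merid (x : X) (t : I) :
    M.susp.vec (merid x t) = ((1 - |2 * (t : ℝ) - 1|) • M.vec x, 2 * (t : ℝ) - 1) := rfl

theorem susp_vec_north : M.susp.vec north = (0, -1) := rfl

theorem susp_vec_south : M.susp.vec south = (0, 1) := rfl

/-- Suspended maps preserve the height. -/
theorem susp_vec_suspMap_snd {Y : PtdSpace.{v}} {W : Type*} [NormedAddCommGroup W]
    [NormedSpace ℝ W] (N : SphereModel Y W) (f : PMap X Y) (z : PtdHtpy.susp X) :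
    (N.susp.vec ((suspMap f).toMap z)).2 = (M.susp.vec z).2 := by
  obtain ⟨x, t, rfl⟩ := exists_eq_merid z
  rfl

end Susp

section Join

variable {A : PtdSpace.{u}} {B : PtdSpace.{v}} {V W : Type*}
  [NormedAddCommGroup V] [NormedSpace ℝ V] [NormedAddCommGroup W] [NormedSpace ℝ W]
  (M : SphereModel A V) (N : SphereModel B W)

/-- The coordinates of the join. -/
def joinVec : C(PtdHtpy.join A B, V × W) :=
  joinLift ⟨fun x : (A × B) × I =>
    ((1 - (x.2 : ℝ)) • M.vec x.1.1, (x.2 : ℝ) • N.vec x.1.2), by fun_prop⟩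
    (fun a b b' => by simp) (fun a a' b => by simp)

theorem joinVec_push (a : A) (b : B) (t : I) :
    M.joinVec N (joinPush (a, b) t) = ((1 - (t : ℝ)) • M.vec a, (t : ℝ) • N.vec b) := rfl

/-- The join of two spheres is a sphere. -/
def join : SphereModel (PtdHtpy.join A B) (V × W) where
  gauge v := M.gauge v.1 + N.gauge v.2
  continuous_gauge := (M.continuous_gauge.comp continuous_fst).add
    (N.continuous_gauge.comp continuous_snd)
  gauge_smul r hr v := by
    simp only [Prod.smul_fst, Prod.smul_snd, M.gauge_smul r hr, N.gauge_smul r hr]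
    ring
  gauge_pos v hv := by
    have h1 := M.gauge_nonneg v.1
    have h2 := N.gauge_nonneg v.2
    by_contra h
    exact hv (Prod.ext (M.gauge_eq_zero (by linarith)) (N.gauge_eq_zero (by linarith)))
  vec := M.joinVec N
  gauge_vec z := by
    obtain ⟨a, b, t, rfl⟩ := exists_eq_joinPush z
    rw [joinVec_push, M.gauge_smul_vec (sub_nonneg.2 t.2.2), N.gauge_smul_vec t.2.1]
    ring
  injective_vec := by
    intro z z' h
    obtain ⟨a, b, t, rfl⟩ := exists_eq_joinPush z
    obtain ⟨a', b', t', rfl⟩ := exists_eq_joinPush z'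
    rw [joinVec_push, joinVec_push, Prod.mk.injEq] at h
    obtain ⟨h1, h2⟩ := h
    -- The join parameter is the gauge of the second component.
    obtain rfl : t = t' := by
      have := congrArg N.gauge h2
      rw [N.gauge_smul_vec t.2.1, N.gauge_smul_vec t'.2.1] at this
      exact Subtype.ext this
    have ha : (1 - (t : ℝ)) ≠ 0 → a = a' := fun ht =>
      M.injective_vec (smul_right_injective V ht h1)
    have hb : (t : ℝ) ≠ 0 → b = b' := fun ht => N.injective_vec (smul_right_injective W ht h2)
    by_cases ht : (t : ℝ) = 0
    · obtain rfl : t = 0 := Subtype.ext ht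
      obtain rfl := ha (by simp)
      exact (joinPush (a, b)).source.trans (joinPush (a, b')).source.symm
    · obtain rfl := hb ht
      by_cases ht' : 1 - (t : ℝ) = 0
      · obtain rfl : t = 1 := Subtype.ext (sub_eq_zero.1 ht').symm
        exact (joinPush (a, b)).target.trans (joinPush (a', b)).target.symm
      · rw [ha ht']
  exists_vec_eq := by
    rintro ⟨v, w⟩ h
    change M.gauge v + N.gauge w = 1 at h
    have hv := M.gauge_nonneg v
    have hw := N.gauge_nonneg w
    have ha : ∃ a, M.gauge v • M.vec a = v := by
      by_cases hv' : v = 0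
      · exact ⟨A.pt, by rw [hv', M.gauge_zero, zero_smul]⟩
      · exact ⟨M.retr ⟨v, hv'⟩, by rw [M.vec_retr, smul_inv_smul₀ (M.gauge_pos v hv').ne']⟩
    have hb : ∃ b, N.gauge w • N.vec b = w := by
      by_cases hw' : w = 0
      · exact ⟨B.pt, by rw [hw', N.gauge_zero, zero_smul]⟩
      · exact ⟨N.retr ⟨w, hw'⟩, by rw [N.vec_retr, smul_inv_smul₀ (N.gauge_pos w hw').ne']⟩
    obtain ⟨a, ha⟩ := ha
    obtain ⟨b, hb⟩ := hb
    refine ⟨joinPush (a, b) ⟨N.gauge w, hw, by linarith⟩, ?_⟩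
    have : 1 - N.gauge w = M.gauge v := by linarith
    change ((1 - N.gauge w) • M.vec a, N.gauge w • N.vec b) = _
    rw [this, ha, hb]

theorem join_vec_pt : (M.join N).vec (PtdHtpy.join A B).pt = (M.vec A.pt, 0) := by
  change ((1 - ((0 : I) : ℝ)) • M.vec A.pt, ((0 : I) : ℝ) • N.vec B.pt) = _
  simp

end Join

end SphereModel

instance {X : PtdSpace.{u}} [CompactSpace X] : CompactSpace (susp X) :=
  inferInstanceAs (CompactSpace (Pushout (toUnit X) (toUnit X)))

instance {A : PtdSpace.{u}} {B : PtdSpace.{v}} [CompactSpace A] [CompactSpace B] :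
    CompactSpace (join A B) :=
  inferInstanceAs (CompactSpace
    (Pushout (ContinuousMap.fst : C(A × B, A)) (ContinuousMap.snd : C(A × B, B))))

instance (n : ℕ) : CompactSpace (sphere n) := compactSpace_sphere n

/-- Every sphere has coordinates, and a linear functional that is `1` at the base point. -/
theorem exists_sphereModel : ∀ n : ℕ, ∃ (V : Type) (_ : NormedAddCommGroup V)
    (_ : NormedSpace ℝ V) (M : SphereModel (sphere n) V) (l : V →L[ℝ] ℝ),
    l (M.vec (sphere n).pt) = 1
  | 0 => ⟨ℝ, inferInstance, inferInstance, SphereModel.bool, ContinuousLinearMap.id ℝ ℝ, rfl⟩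
  | n + 1 => by
    obtain ⟨V, _, _, M, l, hl⟩ := exists_sphereModel n
    refine ⟨V × ℝ, inferInstance, inferInstance, M.susp (X := sphere n),
      -ContinuousLinearMap.snd ℝ V ℝ, ?_⟩
    change -(-1 : ℝ) = 1
    norm_num

/-! ## Pointed homotopy equivalences -/

/-- Pointed homotopy equivalences. -/
def PMap.IsEquiv {X : PtdSpace.{u}} {Y : PtdSpace.{v}} (f : PMap X Y) : Prop :=
  ∃ e, f.IsHomotopyInverse e

section IsEquiv

variable {X : PtdSpace.{u}} {Y : PtdSpace.{v}} {Z : PtdSpace.{w}}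

theorem PMap.Homotopic.symm {f g : PMap X Y} (h : f.Homotopic g) : g.Homotopic f :=
  ContinuousMap.HomotopicRel.symm h

theorem PMap.Homotopic.trans {f g h : PMap X Y} (h₁ : f.Homotopic g) (h₂ : g.Homotopic h) :
    f.Homotopic h :=
  ContinuousMap.HomotopicRel.trans h₁ h₂

theorem PMap.IsEquiv.of_homotopic {f g : PMap X Y} (hg : g.IsEquiv) (h : f.Homotopic g) :
    f.IsEquiv := by
  obtain ⟨e, h1, h2⟩ := hg
  exact ⟨e, (h.comp_right e).trans h1, (h.comp_left e).trans h2⟩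

theorem PMap.IsEquiv.comp {g : PMap Y Z} {f : PMap X Y} (hg : g.IsEquiv) (hf : f.IsEquiv) :
    (g.comp f).IsEquiv := by
  obtain ⟨e, h1, h2⟩ := hf
  obtain ⟨d, k1, k2⟩ := hg
  exact ⟨e.comp d, ((h1.comp_right d).comp_left g).trans k1,
    ((k2.comp_right f).comp_left e).trans h2⟩

theorem PMap.isEquiv_of_homeomorph {f : PMap X Y} (h : X ≃ₜ Y) (hf : ∀ x, f.toMap x = h x) :
    f.IsEquiv := by
  refine ⟨⟨⟨h.symm, h.symm.continuous⟩, ?_⟩, ?_, ?_⟩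
  · exact (h.symm_apply_eq).2 (f.map_pt.symm.trans (hf _))
  · have : f.toMap.comp ⟨h.symm, h.symm.continuous⟩ = ContinuousMap.id Y := by
      ext y
      exact (hf _).trans (h.apply_symm_apply y)
    change (f.toMap.comp ⟨h.symm, h.symm.continuous⟩).HomotopicRel _ _
    rw [this]
    exact .refl _
  · have : (⟨h.symm, h.symm.continuous⟩ : C(Y, X)).comp f.toMap = ContinuousMap.id X := by
      ext x
      exact (congrArg h.symm (hf _)).trans (h.symm_apply_apply x)
    change ((⟨h.symm, h.symm.continuous⟩ : C(Y, X)).comp f.toMap).HomotopicRel _ _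
    rw [this]
    exact .refl _

theorem suspMap_comp (g : PMap Y Z) (f : PMap X Y) :
    suspMap (g.comp f) = (suspMap g).comp (suspMap f) := by
  have : (suspMap (g.comp f)).toMap = ((suspMap g).comp (suspMap f)).toMap := by
    ext z
    obtain ⟨x, t, rfl⟩ := exists_eq_merid z
    rfl
  cases h : suspMap (g.comp f)
  cases h' : (suspMap g).comp (suspMap f)
  rw [h, h'] at this
  cases this
  rfl

theorem suspMap_id : suspMap (PMap.id X) = PMap.id (susp X) := by
  have : (suspMap (PMap.id X)).toMap = (PMap.id (susp X)).toMap := by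
    ext z
    obtain ⟨x, t, rfl⟩ := exists_eq_merid z
    rfl
  cases h : suspMap (PMap.id X)
  cases h' : PMap.id (susp X)
  rw [h, h'] at this
  cases this
  rfl

theorem PMap.Homotopic.toMap {f g : PMap X Y} (h : f.Homotopic g) : f.toMap.Homotopic g.toMap :=
  let ⟨H⟩ := h
  ⟨H.toHomotopy⟩

theorem PMap.IsEquiv.suspMap {f : PMap X Y} (hf : f.IsEquiv) : (suspMap f).IsEquiv := by
  obtain ⟨e, h1, h2⟩ := hf
  refine ⟨PtdHtpy.suspMap e, ?_, ?_⟩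
  · rw [← suspMap_comp, ← suspMap_id]
    exact suspMap_homotopic h1.toMap
  · rw [← suspMap_comp, ← suspMap_id]
    exact suspMap_homotopic h2.toMap

end IsEquiv

end

end PtdHtpy

namespace PtdHtpy

noncomputable section

/-! ## The join of two spheres -/

section JoinToSusp

variable {A : PtdSpace.{u}} {B : PtdSpace.{v}} {X : PtdSpace.{w}}

/-- The map `A * B → Susp X` with `inl a ↦ north`, `inr b ↦ south` and
`push (a, b) t ↦ merid (c (a, b)) t`. -/
def joinToSusp (c : C(A × B, X)) : PMap (join A B) (susp X) where
  toMap := joinDesc (ContinuousMap.const _ (north : susp X))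
    (ContinuousMap.const _ (south : susp X))
    (fun x => merid (c x))
    (continuous_merid.comp (by fun_prop : Continuous fun x : (A × B) × I => (c x.1, x.2)))
  map_pt := rfl

/-- Free homotopies suffice to deform `joinToSusp c`. -/
theorem joinToSusp_homotopic {c c' : C(A × B, X)} (h : c.Homotopic c') :
    (joinToSusp c).Homotopic (joinToSusp c') := by
  obtain ⟨H⟩ := h
  refine join_homotopicRel (fun y : ((A × B) × I) × I => merid (H (y.2, y.1.1)) y.1.2)
    (continuous_merid.comp (by fun_prop : Continuous
      fun y : ((A × B) × I) × I => (H (y.2, y.1.1), y.1.2)))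
    (fun a b b' s => ?_) (fun a a' b s => ?_) (fun x t => ?_) (fun x t => ?_) (fun s => ?_)
  · exact (merid _).source.trans (merid _).source.symm
  · exact (merid _).target.trans (merid _).target.symm
  · exact congrArg (fun y => merid y t) (H.apply_zero x)
  · exact congrArg (fun y => merid y t) (H.apply_one x)
  · exact (merid _).source

/-- In the inductive definition of the cup product, `σ` may be replaced by the meridians. -/
theorem exists_homotopic_merid [LocallyCompactSpace B] (c : C(A × B, X))
    (c' : C(susp A × B, susp X)) (hc' : ∀ a i b, c' (merid a i, b) = sigma (c (a, b)) i) :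
    ∃ c₀ : C(susp A × B, susp X), (∀ a i b, c₀ (merid a i, b) = merid (c (a, b)) i) ∧
      c₀.Homotopic c' := by
  have hcont : Continuous fun y : (A × I) × B × I =>
      sigma (c (y.1.1, y.2.1)) (growTime y.1.2 y.2.2) :=
    continuous_sigma.comp (by fun_prop : Continuous
      fun y : (A × I) × B × I => (c (y.1.1, y.2.1), growTime y.1.2 y.2.2))
  -- Over `south` the homotopy retraces `merid X.pt` to `north`, so it is only free;
  -- `joinToSusp_homotopic` needs no more. Local compactness of `B` allows uncurrying.
  let D : C(susp A, C(B × I, susp X)) := suspDesc (ContinuousMap.const _ north)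
    ⟨fun y => merid X.pt (unitInterval.symm y.2), by fun_prop⟩
    (fun a => ⟨⟨fun i => ContinuousMap.curry ⟨_, hcont⟩ (a, i), by fun_prop⟩,
      by ext y; exact sigma_growTime_zero_left _ _, by ext y; exact sigma_growTime_one_left _ _⟩)
    (ContinuousMap.curry ⟨_, hcont⟩).continuous
  have hD : ∀ a i b s, D (merid a i) (b, s) = sigma (c (a, b)) (growTime i s) := fun _ _ _ _ => rfl
  refine ⟨⟨fun y => D y.1 (y.2, 0), by fun_prop⟩, fun a i b => ?_,
    ⟨⟨⟨fun y => D y.2.1 (y.2.2, y.1), by fun_prop⟩, fun y => rfl, fun y => ?_⟩⟩⟩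
  · exact sigma_growTime_zero _ _
  · obtain ⟨z, b⟩ := y
    obtain ⟨a, i, rfl⟩ := exists_eq_merid z
    rw [hc']
    change D (merid a i) (b, 1) = _
    rw [hD, growTime_one]

end JoinToSusp

/-! ### Linear coordinate changes. -/

section LinearEquiv

variable (V W : Type*) [NormedAddCommGroup V] [NormedSpace ℝ V] [NormedAddCommGroup W]
  [NormedSpace ℝ W]

/-- The coordinate change behind `Susp A * B ≃ Susp (A * B)`. -/
def shuffleEquiv : ((V × ℝ) × W) ≃L[ℝ] ((V × W) × ℝ) where
  toFun v := ((v.1.1, v.2), v.1.2)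
  invFun v := ((v.1.1, v.2), v.1.2)
  map_add' _ _ := rfl
  map_smul' _ _ := rfl
  left_inv _ := rfl
  right_inv _ := rfl
  continuous_toFun := by fun_prop
  continuous_invFun := by fun_prop

/-- The reflection of the second coordinate. -/
def reflectEquiv : ((V × ℝ) × ℝ) ≃L[ℝ] ((V × ℝ) × ℝ) where
  toFun v := ((v.1.1, -v.1.2), v.2)
  invFun v := ((v.1.1, -v.1.2), v.2)
  map_add' x y := Prod.ext (Prod.ext rfl (neg_add _ _)) rfl
  map_smul' r x := Prod.ext (Prod.ext rfl (smul_neg r x.1.2).symm) rfl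
  left_inv x := Prod.ext (Prod.ext rfl (neg_neg _)) rfl
  right_inv x := Prod.ext (Prod.ext rfl (neg_neg _)) rfl
  continuous_toFun := by fun_prop
  continuous_invFun := by fun_prop

variable {V W}

/-- A half turn in the plane spanned by `p` and the last coordinate vector. -/
def halfTurnEquiv (l : V →L[ℝ] ℝ) (p : V) (hp : l p = 1) : (V × ℝ) ≃L[ℝ] (V × ℝ) where
  toFun v := (v.1 - (2 * l v.1) • p, -v.2)
  invFun v := (v.1 - (2 * l v.1) • p, -v.2)
  map_add' x y := Prod.ext (by simp only [Prod.fst_add, map_add]; module) (neg_add _ _)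
  map_smul' r x := Prod.ext
    (by simp only [Prod.smul_fst, map_smul, smul_eq_mul, RingHom.id_apply]; module)
    (smul_neg r x.2).symm
  left_inv x := Prod.ext (by simp only [map_sub, map_smul, hp, smul_eq_mul]; module) (neg_neg _)
  right_inv x := Prod.ext (by simp only [map_sub, map_smul, hp, smul_eq_mul]; module) (neg_neg _)
  continuous_toFun := by fun_prop
  continuous_invFun := by fun_prop

end LinearEquiv

/-! ### The inductive step: suspending the first variable. -/

section Step

variable {A : PtdSpace.{u}} {B : PtdSpace.{v}} {X : PtdSpace.{w}} {U V W : Type*}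
  [NormedAddCommGroup U] [NormedSpace ℝ U] [NormedAddCommGroup V] [NormedSpace ℝ V]
  [NormedAddCommGroup W] [NormedSpace ℝ W]
  [CompactSpace A] [CompactSpace B] [CompactSpace X]

/-- The homeomorphism `Susp A * B ≃ Susp (A * B)` of spheres. -/
def shuffleMap (M : SphereModel A V) (N : SphereModel B W) :
    PMap (join (susp A) B) (susp (join A B)) where
  toMap := ⟨M.susp.join N |>.linHomeo (M.join N).susp (shuffleEquiv V W),
    (M.susp.join N |>.linHomeo (M.join N).susp (shuffleEquiv V W)).continuous⟩
  map_pt := by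
    refine (M.susp.join N).linMap_eq (M.join N).susp (L := shuffleEquiv V W) one_pos ?_
    rw [SphereModel.join_vec_pt, one_smul]
    rfl

theorem vec_shuffleMap (M : SphereModel A V) (N : SphereModel B W) (z : join (susp A) B) :
    (M.join N).susp.vec ((shuffleMap M N).toMap z) =
      shuffleEquiv V W ((M.susp.join N).vec z) := by
  refine (M.susp.join N).vec_linMap_of_gauge (M.join N).susp (fun v => ?_) z
  change (M.gauge v.1.1 + N.gauge v.2) + |v.1.2| = (M.gauge v.1.1 + |v.1.2|) + N.gauge v.2
  ring

/-- The reflection of `Susp (Susp X)` in the inner suspension coordinate. -/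
def reflectMap (M : SphereModel X U) : PMap (susp (susp X)) (susp (susp X)) where
  toMap := ⟨M.susp.susp.linHomeo M.susp.susp (reflectEquiv U),
    (M.susp.susp.linHomeo M.susp.susp (reflectEquiv U)).continuous⟩
  map_pt := by
    refine M.susp.susp.linMap_eq M.susp.susp (L := reflectEquiv U) one_pos ?_
    have h : M.susp.susp.vec (susp (susp X)).pt = ((0, 0), -1) := rfl
    rw [h, one_smul]
    exact Prod.ext (Prod.ext rfl neg_zero) rfl

theorem vec_reflectMap (M : SphereModel X U) (z : susp (susp X)) :
    M.susp.susp.vec ((reflectMap M).toMap z) = reflectEquiv U (M.susp.susp.vec z) := by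
  refine M.susp.susp.vec_linMap_of_gauge M.susp.susp (fun v => ?_) z
  change (M.gauge v.1.1 + |(-v.1.2)|) + |v.2| = (M.gauge v.1.1 + |v.1.2|) + |v.2|
  rw [abs_neg]

theorem one_sub_sq_add_sq_pos (s : ℝ) : 0 < (1 - s) ^ 2 + s ^ 2 := by
  nlinarith [sq_nonneg (2 * s - 1)]

/-- If `joinToSusp c` is an equivalence, then so is the map obtained by suspending `c` in its first
variable. -/
theorem joinToSusp_isEquiv_of_merid (M : SphereModel A V) (N : SphereModel B W)
    (K : SphereModel X U) (c : C(A × B, X)) (c₀ : C(susp A × B, susp X))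
    (hc₀ : ∀ a i b, c₀ (merid a i, b) = merid (c (a, b)) i) (hc : (joinToSusp c).IsEquiv) :
    (joinToSusp c₀).IsEquiv := by
  -- Compared with `joinToSusp c₀`, the two suspension coordinates of `G` are essentially exchanged.
  -- An exchange is a reflection followed by a rotation, which explains `reflectMap`.
  let G := (suspMap (joinToSusp c)).comp (shuffleMap M N)
  have hT : ((reflectMap K).comp G).IsEquiv :=
    (PMap.isEquiv_of_homeomorph (K.susp.susp.linHomeo K.susp.susp (reflectEquiv U))
      fun _ => rfl).comp (hc.suspMap.comp
        (PMap.isEquiv_of_homeomorph (M.susp.join N |>.linHomeo (M.join N).susp (shuffleEquiv V W))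
          fun _ => rfl))
  refine hT.of_homotopic ?_
  let P : C(join (susp A) B, (U × ℝ) × ℝ) := K.susp.susp.vec.comp (joinToSusp c₀).toMap
  let Q : C(join (susp A) B, (U × ℝ) × ℝ) := K.susp.susp.vec.comp G.toMap
  -- Off the equator of the shuffled join only the heights are compared: they never have opposite
  -- signs. On the equator, or where `j = 1`, the exchange is exact.
  have hPQ : ∀ z, (∃ r r' h : ℝ, 0 ≤ r ∧ 0 < r' ∧ h ≠ 0 ∧ (P z).1.2 = r * h ∧ (Q z).2 = r' * h) ∨
      P z = (((Q z).1.1, (Q z).2), (Q z).1.2) := by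
    intro z
    obtain ⟨y, b, j, rfl⟩ := exists_eq_joinPush z
    obtain ⟨a, i, rfl⟩ := exists_eq_merid y
    have hP : P (joinPush (merid a i, b) j) = ((1 - |2 * (j : ℝ) - 1|) •
        ((1 - |2 * (i : ℝ) - 1|) • K.vec (c (a, b)), 2 * (i : ℝ) - 1), 2 * (j : ℝ) - 1) := by
      change K.susp.susp.vec (merid (c₀ (merid a i, b)) j) = _
      rw [hc₀]
      rfl
    have hz : (M.susp.join N).vec (joinPush (merid a i, b) j) = ((1 - (j : ℝ)) •
        ((1 - |2 * (i : ℝ) - 1|) • M.vec a, 2 * (i : ℝ) - 1), (j : ℝ) • N.vec b) := rfl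
    have hsh : (M.join N).susp.vec ((shuffleMap M N).toMap (joinPush (merid a i, b) j)) =
        (((1 - (j : ℝ)) • (1 - |2 * (i : ℝ) - 1|) • M.vec a, (j : ℝ) • N.vec b),
          (1 - (j : ℝ)) * (2 * (i : ℝ) - 1)) :=
      (vec_shuffleMap M N _).trans (congrArg (shuffleEquiv V W) hz)
    have hj := j.2.2
    by_cases h : (1 - (j : ℝ)) * (2 * i - 1) = 0
    · right
      let m : I := ⟨1 / 2, by norm_num, by norm_num⟩
      have hm : 2 * (m : ℝ) - 1 = 0 := by norm_num [m]
      have hS : (shuffleMap M N).toMap (joinPush (merid a i, b) j) =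
          merid (joinPush (a, b) j) m := by
        apply (M.join N).susp.injective_vec
        have hv : (M.join N).susp.vec (merid (joinPush (a, b) j) m) =
            ((1 - |2 * (m : ℝ) - 1|) • ((1 - (j : ℝ)) • M.vec a, (j : ℝ) • N.vec b),
              2 * (m : ℝ) - 1) := rfl
        refine hsh.trans (Eq.trans ?_ hv.symm)
        rw [hm]
        refine Prod.ext (Prod.ext ?_ ?_) h
        · change (1 - (j : ℝ)) • (1 - |2 * (i : ℝ) - 1|) • M.vec a =
            (1 - |(0 : ℝ)|) • (1 - (j : ℝ)) • M.vec a
          rcases mul_eq_zero.1 h with h | h <;> simp [h]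
        · change (j : ℝ) • N.vec b = (1 - |(0 : ℝ)|) • (j : ℝ) • N.vec b
          simp
      have hQ : Q (joinPush (merid a i, b) j) =
          (((1 - |2 * (j : ℝ) - 1|) • K.vec (c (a, b)), 2 * (j : ℝ) - 1), 0) := by
        change K.susp.susp.vec ((suspMap (joinToSusp c)).toMap
          ((shuffleMap M N).toMap (joinPush (merid a i, b) j))) = _
        rw [hS]
        change ((1 - |2 * (m : ℝ) - 1|) •
          ((1 - |2 * (j : ℝ) - 1|) • K.vec (c (a, b)), 2 * (j : ℝ) - 1), 2 * (m : ℝ) - 1) = _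
        rw [hm]
        simp
      rw [hP, hQ]
      rcases mul_eq_zero.1 h with h | h
      · have : (j : ℝ) = 1 := by linarith
        rw [this]
        norm_num
        rfl
      · rw [h]
        simp
    · left
      refine ⟨1 - |2 * (j : ℝ) - 1|, 1 - j, 2 * i - 1, SphereModel.one_sub_abs_nonneg j, ?_,
        right_ne_zero_of_mul h, ?_, ?_⟩
      · exact lt_of_le_of_ne (sub_nonneg.2 hj) (left_ne_zero_of_mul h).symm
      · rw [hP]
        rfl
      · change (K.susp.susp.vec ((suspMap (joinToSusp c)).toMap
          ((shuffleMap M N).toMap (joinPush (merid a i, b) j)))).2 = _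
        exact ((M.join N).susp_vec_suspMap_snd K.susp _ _).trans (congrArg Prod.snd hsh)
  have hP0 : ∀ z, P z ≠ 0 := fun z => K.susp.susp.vec_ne_zero _
  let p : I × join (susp A) B → ℝ := fun y => (1 - (y.1 : ℝ)) * (P y.2).1.2 + y.1 * (Q y.2).2
  let q : I × join (susp A) B → ℝ := fun y => (1 - (y.1 : ℝ)) * (P y.2).2 + y.1 * (Q y.2).1.2
  have hp : Continuous p := by fun_prop
  have hq : Continuous q := by fun_prop
  -- While `P` is interpolated to `Q` with exchanged coordinates, the plane of `(p, q)` is turned by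
  -- the matrix with rows `(1 - s, -s)` and `(s, 1 - s)`. Its determinant `(1 - s)² + s²` is
  -- positive, and at `s = 1` it is a quarter turn.
  refine K.susp.susp.homotopicRel (fun y =>
    (((1 - (y.1 : ℝ)) • (P y.2).1.1 + (y.1 : ℝ) • (Q y.2).1.1,
    (1 - (y.1 : ℝ)) * p y - y.1 * q y), y.1 * p y + (1 - (y.1 : ℝ)) * q y)) (by fun_prop)
    ?_ ?_ ?_ ?_
  · rintro ⟨s, z⟩ h
    simp only [Prod.mk_eq_zero] at h
    obtain ⟨⟨h1, h2⟩, h3⟩ := h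
    have hs := one_sub_sq_add_sq_pos s
    have hp0 : p (s, z) = 0 :=
      (mul_eq_zero.1 (by linear_combination (1 - (s : ℝ)) * h2 + s * h3 :
        ((1 - (s : ℝ)) ^ 2 + (s : ℝ) ^ 2) * p (s, z) = 0)).resolve_left hs.ne'
    have hq0 : q (s, z) = 0 :=
      (mul_eq_zero.1 (by linear_combination (1 - (s : ℝ)) * h3 - s * h2 :
        ((1 - (s : ℝ)) ^ 2 + (s : ℝ) ^ 2) * q (s, z) = 0)).resolve_left hs.ne'
    simp only [p, q] at hp0 hq0
    -- In the first case `p = 0` forces `s = 0`, where the homotopy is `P` itself. In the second the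
    -- interpolation is constant and again gives `P z = 0`.
    rcases hPQ z with ⟨r, r', t, hr, hr', ht, e1, e2⟩ | e
    · rw [e1, e2] at hp0
      have h0 : (1 - (s : ℝ)) * r + s * r' = 0 :=
        (mul_eq_zero.1 (by linear_combination hp0 :
          ((1 - (s : ℝ)) * r + s * r') * t = 0)).resolve_right ht
      have h4 : 0 ≤ (1 - (s : ℝ)) * r := mul_nonneg (sub_nonneg.2 s.2.2) hr
      have h5 : 0 ≤ (s : ℝ) * r' := mul_nonneg s.2.1 hr'.le
      have hs0 : (s : ℝ) = 0 :=
        (mul_eq_zero.1 (by linarith : (s : ℝ) * r' = 0)).resolve_right hr'.ne'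
      have hr0 : r = 0 := by simpa [hs0] using h0
      refine hP0 z (Prod.ext (Prod.ext ?_ ?_) ?_)
      · simpa [hs0] using h1
      · simp [e1, hr0]
      · simpa [hs0] using hq0
    · have e1 : (Q z).1.1 = (P z).1.1 := by rw [e]
      have e2 : (Q z).2 = (P z).1.2 := by rw [e]
      have e3 : (Q z).1.2 = (P z).2 := by rw [e]
      rw [e1, ← add_smul, sub_add_cancel, one_smul] at h1
      rw [e2] at hp0
      rw [e3] at hq0
      exact hP0 z (Prod.ext (Prod.ext h1 (by simp only [Prod.fst_zero, Prod.snd_zero]; linarith))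
        (by simp only [Prod.snd_zero]; linarith))
  · intro z
    simp [p, q, P]
  · intro z
    refine ⟨1, one_pos, ?_⟩
    change _ = (1 : ℝ) • K.susp.susp.vec ((reflectMap K).toMap (G.toMap z))
    rw [one_smul, vec_reflectMap]
    change _ = (((Q z).1.1, -(Q z).1.2), (Q z).2)
    simp [p, q]
  -- Here `p = -s` and `q = -(1 - s)`: interpolation and rotation cancel up to a positive factor, so
  -- the base point stays fixed.
  · rintro z rfl s
    refine ⟨(1 - (s : ℝ)) ^ 2 + s ^ 2, one_sub_sq_add_sq_pos s, ?_⟩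
    have h1 : P (join (susp A) B).pt = ((0, 0), -1) :=
      congrArg K.susp.susp.vec (joinToSusp c₀).map_pt
    have h2 : Q (join (susp A) B).pt = ((0, 0), -1) := congrArg K.susp.susp.vec G.map_pt
    change _ = _ • P (join (susp A) B).pt
    simp only [p, q, h1, h2]
    refine Prod.ext (Prod.ext ?_ ?_) ?_
    · simp
    · simp only [Prod.smul_fst, Prod.smul_snd, smul_eq_mul]
      ring
    · simp only [Prod.smul_snd, smul_eq_mul]
      ring

end Step

/-! ### The base case: the join with `S⁰`. -/

section Base

variable {B : PtdSpace.{0}} {W : Type*} [NormedAddCommGroup W] [NormedSpace ℝ W]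

/-- The points of `S⁰`. -/
def signPt (c : Bool) : sphere 0 := c

theorem eq_signPt (a : sphere 0) : a = signPt false ∨ a = signPt true :=
  Bool.eq_false_or_eq_true a |>.symm

/-- Maps out of `S⁰ × Y` are continuous if both restrictions are. -/
theorem continuous_sphere_zero_prod {Y Z : Type*} [TopologicalSpace Y] [TopologicalSpace Z]
    {f : sphere 0 × Y → Z} (h : ∀ c, Continuous fun y => f (signPt c, y)) : Continuous f := by
  have : Continuous fun x : Bool × Y => f (signPt x.1, x.2) :=
    continuous_prod_of_discrete_left.2 h
  exact this

/-- The cup product with `S⁰`. -/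
def cupZero (B : PtdSpace.{0}) : C(sphere 0 × B, B) :=
  ⟨fun x => cond x.1 B.pt x.2, continuous_sphere_zero_prod fun c => by
    cases c
    · exact continuous_id
    · exact continuous_const⟩

/-- Contraction of the cone over `true` in the join `S⁰ * B`, followed by `joinToSusp`. -/
def contractCone (y : ((sphere 0 × B) × I) × I) : susp B :=
  merid (cupZero B y.1.1) (cond y.1.1.1 (lineTime y.1.2 1 y.2) y.1.2)

theorem continuous_contractCone : Continuous (contractCone (B := B)) := by
  have h : Continuous fun y : sphere 0 × I × I =>
      (cond y.1 (lineTime y.2.1 1 y.2.2) y.2.1 : I) := by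
    refine continuous_sphere_zero_prod fun c => ?_
    cases c
    · exact continuous_fst
    · exact (by fun_prop : Continuous fun y : I × I => lineTime y.1 1 y.2)
  exact continuous_merid.comp ((by fun_prop : Continuous
    fun y : ((sphere 0 × B) × I) × I => cupZero B y.1.1).prodMk (h.comp (by fun_prop :
      Continuous fun y : ((sphere 0 × B) × I) × I => (y.1.1.1, y.1.2, y.2))))

/-- The base point `inl true` travels along `merid B.pt` from `north` to `south`, so this
contraction is not pointed. -/
theorem contractCone_zero (a : sphere 0) (b : B) (s : I) :
    contractCone (((a, b), 0), s) = merid B.pt (cond a s 0) := by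
  rcases eq_signPt a with rfl | rfl
  · exact (merid b).source.trans (merid B.pt).source.symm
  · exact congrArg (merid B.pt) (Subtype.ext (by simp [lineTime]))

theorem contractCone_one (x : sphere 0 × B) (s : I) : contractCone ((x, 1), s) = south := by
  obtain ⟨a, b⟩ := x
  rcases eq_signPt a with rfl | rfl
  · exact (merid b).target
  · have : lineTime 1 1 s = 1 := Subtype.ext (by simp [lineTime])
    exact (congrArg (merid B.pt) this).trans (merid B.pt).target

theorem contractCone_start (x : sphere 0 × B) (t : I) :
    contractCone ((x, t), 0) = (joinToSusp (cupZero B)).toMap (joinPush x t) := by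
  obtain ⟨a, b⟩ := x
  rcases eq_signPt a with rfl | rfl
  · rfl
  · have : lineTime t 1 0 = t := Subtype.ext (by simp [lineTime])
    exact congrArg (merid B.pt) this

/-- The end of the contraction. -/
def contractedMap (B : PtdSpace.{0}) : C(join (sphere 0) B, susp B) :=
  joinLift ⟨fun y => contractCone (y, 1), continuous_contractCone.comp (by fun_prop)⟩
    (fun a b b' => (contractCone_zero a b 1).trans (contractCone_zero a b' 1).symm)
    (fun _ _ _ => (contractCone_one _ _).trans (contractCone_one _ _).symm)

theorem contractedMap_true (b : B) (t : I) :
    contractedMap B (joinPush (signPt true, b) t) = south := by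
  have : lineTime t 1 1 = 1 := Subtype.ext (by simp [lineTime])
  exact (congrArg (merid B.pt) this).trans (merid B.pt).target

/-- The rotation of the plane spanned by `p` and the last coordinate vector that moves `c p + d e`
to the ray through `-e`. -/
def rotate (l : W →L[ℝ] ℝ) (p : W) (c d : ℝ) (v : W × ℝ) : W × ℝ :=
  (v.1 + ((-d - 1) * l v.1 + c * v.2) • p, -(c * l v.1) - d * v.2)

/-- The map is the identity on the kernel of `l`, and on the plane of `p` and the last coordinate it
has determinant `c² + d²`. -/
theorem rotate_ne_zero {l : W →L[ℝ] ℝ} {p : W} (hp : l p = 1) {c d : ℝ} (h : c ^ 2 + d ^ 2 ≠ 0)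
    {v : W × ℝ} (hv : v ≠ 0) : rotate l p c d v ≠ 0 := by
  intro h0
  obtain ⟨h1, h2⟩ := Prod.mk_eq_zero.1 h0
  have h3 := congrArg l h1
  simp only [map_add, map_smul, hp, smul_eq_mul, map_zero] at h3
  have e1 : l v.1 = 0 := (mul_eq_zero.1 (by linear_combination -c * h2 - d * h3 :
    (c ^ 2 + d ^ 2) * l v.1 = 0)).resolve_left h
  have e2 : v.2 = 0 := (mul_eq_zero.1 (by linear_combination -d * h2 + c * h3 :
    (c ^ 2 + d ^ 2) * v.2 = 0)).resolve_left h
  rw [e1, e2] at h1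
  exact hv (Prod.ext (by simpa using h1) e2)

theorem sq_add_sq_ne_zero (t : ℝ) : (1 - |2 * t - 1|) ^ 2 + (2 * t - 1) ^ 2 ≠ 0 := by
  rw [← sq_abs (2 * t - 1)]
  nlinarith [sq_nonneg (1 - 2 * |2 * t - 1|)]

/-- `joinToSusp` is an equivalence for the cup product with `S⁰`. -/
theorem joinToSusp_cupZero_isEquiv [CompactSpace B] (N : SphereModel B W) (l : W →L[ℝ] ℝ)
    (hl : l (N.vec B.pt) = 1) : (joinToSusp (cupZero B)).IsEquiv := by
  let J : SphereModel (join (sphere 0) B) (ℝ × W) := SphereModel.bool.join (A := sphere 0) N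
  let R : join (sphere 0) B ≃ₜ susp B := J.linHomeo N.susp (ContinuousLinearEquiv.prodComm ℝ ℝ W)
  let L := halfTurnEquiv l (N.vec B.pt) hl
  let T : susp B ≃ₜ susp B := N.susp.linHomeo N.susp L
  have hR : ∀ z, N.susp.vec (R z) = ((J.vec z).2, (J.vec z).1) := by
    refine J.vec_linMap_of_gauge N.susp (fun v => ?_)
    exact add_comm (N.gauge v.2) |v.1|
  have hRpt : R (join (sphere 0) B).pt = south := by
    apply N.susp.injective_vec
    have hJ : J.vec (join (sphere 0) B).pt = (1, 0) := SphereModel.join_vec_pt _ _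
    rw [hR, hJ]
    rfl
  have hTpt : T south = north := by
    refine N.susp.linMap_eq N.susp (L := L) one_pos ?_
    rw [SphereModel.susp_vec_south, SphereModel.susp_vec_north]
    change ((0 : W) - (2 * l 0) • N.vec B.pt, -(1 : ℝ)) = _
    simp
  let TR : PMap (join (sphere 0) B) (susp B) :=
    ⟨⟨fun z => T (R z), by fun_prop⟩, (congrArg T hRpt).trans hTpt⟩
  have hTR : TR.IsEquiv := PMap.isEquiv_of_homeomorph (R.trans T) fun _ => rfl
  refine hTR.of_homotopic ?_
  -- contracting the cone while rotating the base point back to the north pole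
  have h1 : (joinToSusp (cupZero B)).toMap.HomotopicRel
      ((⟨T, T.continuous⟩ : C(susp B, susp B)).comp (contractedMap B))
      {(join (sphere 0) B).pt} := by
    -- The parameters `c` and `d` are the coordinates of `merid B.pt s`, so the rotation at time `s`
    -- returns the moving base point to `north`. It is the identity at `s = 0` and the half turn at
    -- `s = 1`.
    let rot : I × susp B → W × ℝ := fun y => rotate l (N.vec B.pt) (1 - |2 * (y.1 : ℝ) - 1|)
      (2 * (y.1 : ℝ) - 1) (N.susp.vec y.2)
    have hrot : ∀ y, rot y ≠ 0 := fun y =>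
      rotate_ne_zero hl (sq_add_sq_ne_zero _) (N.susp.vec_ne_zero _)
    have hrotc : Continuous rot := by
      simp only [rot, rotate]
      fun_prop
    let Φ : C(I × susp B, susp B) := ⟨fun y => N.susp.retr ⟨rot y, hrot y⟩,
      N.susp.continuous_retr.comp (hrotc.subtype_mk _)⟩
    have hΦ0 : ∀ y, Φ (0, y) = y := fun y => N.susp.retr_eq one_pos (by
      rw [one_smul]
      simp [rot, rotate])
    have hΦ1 : ∀ y, Φ (1, y) = T y := fun y => by
      refine congrArg N.susp.retr (Subtype.ext ?_)
      refine Prod.ext ?_ ?_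
      · simp only [rot, rotate, L, halfTurnEquiv]
        change _ = (N.susp.vec y).1 - (2 * l (N.susp.vec y).1) • N.vec B.pt
        norm_num
        module
      · change _ = -(N.susp.vec y).2
        norm_num [rot, rotate]
    have hΦm : ∀ s, Φ (s, merid B.pt s) = north := fun s => by
      refine N.susp.retr_eq (lt_of_le_of_ne (by positivity) (sq_add_sq_ne_zero (s : ℝ)).symm) ?_
      rw [SphereModel.susp_vec_north]
      simp only [rot, rotate, SphereModel.susp_vec_merid, map_smul, hl, smul_eq_mul]
      refine Prod.ext ?_ ?_
      · simp only [Prod.smul_fst, smul_zero]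
        module
      · simp only [Prod.smul_snd, smul_eq_mul]
        ring
    refine join_homotopicRel (fun y => Φ (y.2, contractCone y))
      (Φ.continuous.comp (continuous_snd.prodMk continuous_contractCone))
      (fun a b b' s => ?_) (fun a a' b s => ?_) (fun x t => ?_) (fun x t => ?_) (fun s => ?_)
    · rw [contractCone_zero, contractCone_zero]
    · rw [contractCone_one, contractCone_one]
    · exact (hΦ0 _).trans (contractCone_start x t)
    · exact hΦ1 (contractCone ((x, t), 1))
    · exact (congrArg (fun w => Φ (s, w)) (contractCone_zero _ _ s)).trans (hΦm s)
  -- the contracted map is homotopic to a homeomorphism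
  have h2 : (contractedMap B).HomotopicRel ⟨R, R.continuous⟩ {(join (sphere 0) B).pt} := by
    have hct : contractedMap B (join (sphere 0) B).pt = south :=
      (congrArg (contractedMap B) (joinPush (signPt true, B.pt)).source.symm).trans
        (contractedMap_true B.pt 0)
    let P : C(join (sphere 0) B, W × ℝ) := N.susp.vec.comp (contractedMap B)
    let Q : C(join (sphere 0) B, W × ℝ) := N.susp.vec.comp ⟨R, R.continuous⟩
    refine N.susp.homotopicRel
      (fun y => (1 - (y.1 : ℝ)) • P y.2 + (y.1 : ℝ) • Q y.2) (by fun_prop) ?_ ?_ ?_ ?_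
    · rintro ⟨s, z⟩ h
      obtain ⟨a, b, t, rfl⟩ := exists_eq_joinPush z
      have hs0 := s.2.1
      have hs1 := sub_nonneg.2 s.2.2
      have ht0 := t.2.1
      have ht1 := sub_nonneg.2 t.2.2
      have hb := N.vec_ne_zero b
      rcases eq_signPt a with rfl | rfl
      -- On this cone the first components of `P` and `Q` are nonnegative multiples of the same
      -- vector, so they cannot cancel.
      · have hP : P (joinPush (signPt false, b) t) =
            ((1 - |2 * (t : ℝ) - 1|) • N.vec b, 2 * (t : ℝ) - 1) := rfl
        have hQ : Q (joinPush (signPt false, b) t) =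
            ((t : ℝ) • N.vec b, (1 - (t : ℝ)) * (-1)) := hR _
        have h' := h
        simp only [hP, hQ] at h'
        have e1 : ((1 - (s : ℝ)) * (1 - |2 * (t : ℝ) - 1|) + s * t) • N.vec b = 0 := by
          have := congrArg Prod.fst h'
          rw [add_smul, mul_smul, mul_smul]
          exact this
        have e2 : (1 - (s : ℝ)) * (2 * t - 1) + s * ((1 - t) * (-1)) = 0 :=
          congrArg Prod.snd h'
        have e3 := (smul_eq_zero.1 e1).resolve_right hb
        have n1 : 0 ≤ (1 - (s : ℝ)) * (1 - |2 * (t : ℝ) - 1|) :=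
          mul_nonneg hs1 (SphereModel.one_sub_abs_nonneg t)
        have n2 : 0 ≤ (s : ℝ) * t := mul_nonneg hs0 ht0
        rcases mul_eq_zero.1 (by linarith : (s : ℝ) * t = 0) with h0 | h0
        · rw [h0] at e2 e3
          have : 2 * (t : ℝ) - 1 = 0 := by linarith
          rw [this] at e3
          norm_num at e3
        · rw [h0] at e2
          linarith
      · have hP : P (joinPush (signPt true, b) t) = (0, 1) :=
          congrArg N.susp.vec (contractedMap_true b t)
        have hQ : Q (joinPush (signPt true, b) t) =
            ((t : ℝ) • N.vec b, (1 - (t : ℝ)) * 1) := hR _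
        have h' := h
        simp only [hP, hQ] at h'
        have e1 : ((s : ℝ) * t) • N.vec b = 0 := by
          have := congrArg Prod.fst h'
          simpa [mul_smul] using this
        have e2 : (1 - (s : ℝ)) * 1 + s * ((1 - t) * 1) = 0 := congrArg Prod.snd h'
        have e3 := (smul_eq_zero.1 e1).resolve_right hb
        linarith
    · intro z
      simp [P]
    · intro z
      exact ⟨1, one_pos, by simp [Q]⟩
    · rintro z rfl s
      refine ⟨1, one_pos, ?_⟩
      have hP : P (join (sphere 0) B).pt = N.susp.vec south := congrArg N.susp.vec hct
      have hQ : Q (join (sphere 0) B).pt = N.susp.vec south := congrArg N.susp.vec hRpt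
      change _ = (1 : ℝ) • P (join (sphere 0) B).pt
      simp only [hP, hQ]
      module
  exact h1.trans (h2.comp_continuousMap ⟨T, T.continuous⟩)

end Base

/-- Induction on `n` with `m` fixed. The cup product is first replaced by its version with meridians
in place of `σ`, to which the suspension step applies. -/
theorem joinSphere_isEquiv (m : ℕ) : ∀ n, (joinSphere n m).IsEquiv
  | 0 => by
    obtain ⟨W, _, _, N, l, hl⟩ := exists_sphereModel m
    have h : (⟨fun x : sphere 0 × sphere m => cup m 0 x.1 x.2, by fun_prop⟩ :
        C(sphere 0 × sphere m, sphere m)) = cupZero (sphere m) := by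
      ext ⟨a, b⟩
      change Bool at a
      cases a <;> rfl
    have := joinToSusp_cupZero_isEquiv N l hl
    rw [← h] at this
    exact this
  | n + 1 => by
    obtain ⟨V, _, _, M, -, -⟩ := exists_sphereModel n
    obtain ⟨W, _, _, N, -, -⟩ := exists_sphereModel m
    obtain ⟨U, _, _, K, -, -⟩ := exists_sphereModel (m + n)
    let c : C(sphere n × sphere m, sphere (m + n)) := ⟨fun x => cup m n x.1 x.2, by fun_prop⟩
    let c' : C(susp (sphere n) × sphere m, susp (sphere (m + n))) :=
      ⟨fun x => cup m (n + 1) x.1 x.2, by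
        exact (by fun_prop : Continuous fun x : sphere (n + 1) × sphere m =>
          cup m (n + 1) x.1 x.2)⟩
    obtain ⟨c₀, hc₀, h⟩ := exists_homotopic_merid c c' fun _ _ _ => rfl
    exact (joinToSusp_isEquiv_of_merid M N K c c₀ hc₀ (joinSphere_isEquiv m n)).of_homotopic
      (joinToSusp_homotopic h).symm

end

end PtdHtpy

theorem theorem6p23 :
    (∀ (A : PtdSpace.{u}) (B : PtdSpace.{v}) (C : PtdSpace.{w})
        (f : PMap (susp A) C) (g : PMap (susp B) C),
      (suspMap (genWhitehead f g)).Homotopic (PMap.const (susp (join A B)) (susp C))) ∧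
    ∀ n m : ℕ,
      (∃ e, (joinSphere n m).IsHomotopyInverse e) ∧
      ∀ e, (joinSphere n m).IsHomotopyInverse e →
        ∀ C : PtdSpace.{w},
          (∀ (f : PMap (sphere (n + 1)) C) (g : PMap (sphere (m + 1)) C),
            HtpyGroup.whitehead e (HtpyGroup.mk f) (HtpyGroup.mk g) =
                HtpyGroup.mk ((genWhitehead (A := sphere n) (B := sphere m) f g).comp e) ∧
            (suspMap ((genWhitehead (A := sphere n) (B := sphere m) f g).comp e)).Homotopic
              (PMap.const (susp (sphere (m + n + 1))) (susp C))) ∧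
          ∀ (x : HtpyGroup (n + 1) C) (y : HtpyGroup (m + 1) C),
            HtpyGroup.suspension (HtpyGroup.whitehead e x y) = 0 := by
  refine ⟨fun A B C f g => suspMap_genWhitehead_homotopic_const f g, fun n m =>
    ⟨joinSphere_isEquiv m n, fun e he C => ?_⟩⟩
  have hmk : ∀ (f : PMap (sphere (n + 1)) C) (g : PMap (sphere (m + 1)) C),
      HtpyGroup.whitehead e (HtpyGroup.mk f) (HtpyGroup.mk g) =
        HtpyGroup.mk ((genWhitehead (A := sphere n) (B := sphere m) f g).comp e) := fun f g =>
    Quotient.sound ((whiteheadComp_homotopic_genWhitehead (A := sphere n) (B := sphere m)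
      f g).comp_right e)
  have hnull : ∀ (f : PMap (sphere (n + 1)) C) (g : PMap (sphere (m + 1)) C),
      (suspMap ((genWhitehead (A := sphere n) (B := sphere m) f g).comp e)).Homotopic
        (PMap.const (susp (sphere (m + n + 1))) (susp C)) := fun f g => by
    -- Suspension is functorial, so precomposing with any `e` keeps the map null.
    rw [suspMap_comp]
    exact (suspMap_genWhitehead_homotopic_const (A := sphere n) (B := sphere m) f g).comp_right _
  refine ⟨fun f g => ⟨hmk f g, hnull f g⟩, fun x y => ?_⟩
  induction x using Quotient.ind with
  | _ f =>
  induction y using Quotient.ind with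
  | _ g =>
  refine (congrArg HtpyGroup.suspension (hmk f g)).trans ?_
  exact Quotient.sound ((suspMap_homotopic_sigmaAdj _).symm.trans (hnull f g))
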